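/- Let $\mathfrak g$ be a finite-dimensional real Lie algebra with an ad-invariant inner product $\langle\cdot,\cdot\rangle$ (equivalently, the Lie algebra of a compact connected Lie group with an invariant inner product). Let $\mathfrak l\subset\mathfrak k\subset\mathfrak g$ be subalgebras such that $(\mathfrak g,\mathfrak k)$ is a symmetric pair, i.e. with $\mathfrak w=\mathfrak k^\perp$ one has $[\mathfrak w,\mathfrak w]\subset\mathfrak k$ and $[\mathfrak k,\mathfrak w]\subset\mathfrak w$. Let $\mathfrak w=\mathfrak w_0\oplus\mathfrak w_1\oplus\dots\oplus\mathfrak w_m$ be an orthogonal decomposition, where $\mathfrak w_0=\{x\in\mathfrak w: [\mathfrak l,x]=0\}$ and $\mathfrak w_1,\dots,\mathfrak w_m$ are irreducible for the adjoint action of $\mathfrak l$. Let $\mathfrak d\subset\mathfrak g$ be a subspace of the form $$\mathfrak d=\mathfrak u+\mathfrak d_0+\mathfrak d_1+\dots+\mathfrak d_g,\qquad \mathfrak u=\mathfrak d\cap\mathfrak l,\quad \mathfrak d_k=\mathfrak d\cap\mathfrak w_k,\qquad g\le m,$$ with $\dim\mathfrak u\ge 1$ and $\mathfrak d_k\ne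 0$ for $k=1,\dots,g$. Let $\mathcal A:\mathfrak g\to\mathfrak g$ be a symmetric positive definite operator which preserves $\mathfrak u,\mathfrak d_0,\dots,\mathfrak d_g$, with $\mathcal A|_{\mathfrak u}=s\cdot\mathrm{Id}$, $s\in\mathbb R$. The Euler--Poincaré--Suslov (EPS) equations are $$\dot x=[x,\mathcal A x]_{\mathfrak d},\qquad x\in\mathfrak d,$$ where the subscript denotes orthogonal projection to $\mathfrak d$. Let $x_k$ be the orthogonal projection of $x$ to $\mathfrak d_k$ and, for $k=1,\dots,g$, put $B_k=\mathcal A|_{\mathfrak d_k}-s\cdot\mathrm{Id}$, $F_k(x)=\langle B_kx_k,x_k\rangle$; let $F(x)=\langle x,x\rangle$. For $c_0\in\mathfrak d_0$ and $c_1,\dots,c_{g+1}\in\mathbb R$ let $$M_c=\{x\in\mathfrak d: x_0=c_0,\ F_1(x)=c_1,\dots,F_g(x)=c_g,\ F(x)=c_{g+1}\}.$$ **Theorem.** The sets $M_c$ are invariant under the EPS equations. Assume moreover that $B_1,\dots,B_g$ are positive definite, that $c_k>0$ for $k=1,\dots,g$, and that $$c_{g+1}>|c_0|^2+\sum_{k=1}^g\frac{c_k}{b_k},\qquad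 b_k=\min_{\xi\in\mathfrak d_k,\ |\xi|=1}\langle B_k\xi,\xi\rangle .$$ 1. $M_c$ is diffeomorphic to the product of spheres $S^{\dim\mathfrak d_1-1}\times\dots\times S^{\dim\mathfrak d_g-1}\times S^{\dim\mathfrak u-1}$. 2. If $\dim\mathfrak u=1$ and $\dim\mathfrak d_k=2$ for $k=1,\dots,g$, then $M_c$ is the disjoint union of two $g$-dimensional tori, each with angular coordinates $\varphi=(\varphi_1,\dots,\varphi_g)$ modulo $2\pi$ in which the EPS equations take the form $\dot\varphi_i=\Omega_i/\Phi(\varphi)$, $i=1,\dots,g$, where the $\Omega_i$ are real constants, the same on both tori, and $\Phi$ is a smooth positive function, $2\pi$-periodic in each variable. More generally, if $\dim\mathfrak u=1$ and $\dim\mathfrak d_k\le2$ for all $k=1,\dots,g$, the same holds with $2^{1+p}$ tori of dimension $r$, with angles $\varphi_1,\dots,\varphi_r$, where $p$ and $r=g-p$ are the numbers of $k$ with $\dim\mathfrak d_k=1$ and $\dim\mathfrak d_k=2$ respectively. -/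

import Mathlib

open scoped ContDiff

/-- An additive group carrying both a norm and a Lie bracket. -/
class NormedLieRing (L : Type*) extends NormedAddCommGroup L, LieRing L

/-- A real Lie algebra with an ad-invariant inner product. In finite dimension these are exactly
the Lie algebras of compact connected Lie groups, with the restriction of a bi-invariant metric. -/
class InvariantInnerLieAlgebra (L : Type*) [NormedLieRing L]
    extends InnerProductSpace ℝ L, LieAlgebra ℝ L where
  inner_lie : ∀ x y z : L, Inner.inner ℝ ⁅x, y⁆ z = Inner.inner ℝ x ⁅y, z⁆

section Smooth

variable {E F : Type*} [NormedAddCommGroup E] [NormedSpace ℝ E]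
  [NormedAddCommGroup F] [NormedSpace ℝ F]

/-- Smoothness of a map on an arbitrary subset `X` of a normed space: near each point of `X` it is
the restriction of a smooth map defined on an open set of the ambient space. -/
def SmoothOnSubset (f : E → F) (X : Set E) : Prop :=
  ∀ x ∈ X, ∃ U : Set E, IsOpen U ∧ x ∈ U ∧
    ∃ h : E → F, ContDiffOn ℝ ∞ h U ∧ Set.EqOn f h (U ∩ X)

/-- `f` restricts to a diffeomorphism of the subset `X` onto the subset `Y`, with inverse `f'`. -/
structure IsDiffeoOn (f : E → F) (f' : F → E) (X : Set E) (Y : Set F) : Prop where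
  mapsTo : Set.MapsTo f X Y
  mapsTo_inv : Set.MapsTo f' Y X
  invOn : Set.InvOn f' f X Y
  smooth : SmoothOnSubset f X
  smooth_inv : SmoothOnSubset f' Y

/-- The subsets `X` and `Y` of normed spaces are diffeomorphic. -/
def DiffeomorphicSets (X : Set E) (Y : Set F) : Prop :=
  ∃ (f : E → F) (f' : F → E), IsDiffeoOn f f' X Y

end Smooth

/-- The product `S^{n₁-1} × ⋯ × S^{n_g-1} × S^{n-1}` of unit spheres
in `ℝ^{n₁} × ⋯ × ℝ^{n_g} × ℝ^n`. -/
def sphereProduct {g : ℕ} (n : Fin g → ℕ) (n' : ℕ) :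
    Set ((∀ k, EuclideanSpace ℝ (Fin (n k))) × EuclideanSpace ℝ (Fin n')) :=
  {p | (∀ k, ‖p.1 k‖ = 1) ∧ ‖p.2‖ = 1}

/-- The standard `r`-dimensional torus in `ℂ^r`. -/
def stdTorus (r : ℕ) : Set (Fin r → ℂ) := {z | ∀ i, ‖z i‖ = 1}

/-- The point of the standard torus with angular coordinates `φ₁, …, φ_r`. -/
noncomputable def torusPoint {r : ℕ} (φ : Fin r → ℝ) : Fin r → ℂ :=
  fun i => Complex.exp ((φ i : ℂ) * Complex.I)

/-- `(𝔤, 𝔨)` is a symmetric pair: with `𝔴 = 𝔨ᗮ`, one has `[𝔨, 𝔨] ⊆ 𝔨` (as `𝔨` is a subalgebra),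
`[𝔴, 𝔴] ⊆ 𝔨` and `[𝔨, 𝔴] ⊆ 𝔴`. -/
structure IsSymmetricPair {𝔤 : Type*} [NormedLieRing 𝔤] [InvariantInnerLieAlgebra 𝔤]
    (𝔨 : LieSubalgebra ℝ 𝔤) : Prop where
  lie_perp_perp : ∀ x ∈ 𝔨.toSubmoduleᗮ, ∀ y ∈ 𝔨.toSubmoduleᗮ, ⁅x, y⁆ ∈ 𝔨
  lie_perp : ∀ x ∈ 𝔨, ∀ y ∈ 𝔨.toSubmoduleᗮ, ⁅x, y⁆ ∈ 𝔨.toSubmoduleᗮ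

/-- The data of Euler–Poincaré–Suslov equations on a symmetric pair: a chain of subalgebras
`𝔩 ⊆ 𝔨 ⊆ 𝔤` with `(𝔤, 𝔨)` a symmetric pair, the decomposition of `𝔴 = 𝔨ᗮ` under `𝔩`, the constraint
subspace `𝔡` adapted to it, and the compatible operator `A` (the inverse inertia operator). -/
structure EPSData (𝔤 : Type*) [NormedLieRing 𝔤] [InvariantInnerLieAlgebra 𝔤] where
  𝔨 : LieSubalgebra ℝ 𝔤
  𝔩 : LieSubalgebra ℝ 𝔤
  𝔩_le_𝔨 : 𝔩 ≤ 𝔨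
  symmetricPair : IsSymmetricPair 𝔨
  /-- the number of nontrivial irreducible summands of `𝔴` -/
  m : ℕ
  /-- the subspace of `𝔴` on which `𝔩` acts trivially -/
  w₀ : Submodule ℝ 𝔤
  mem_w₀ : ∀ x, x ∈ w₀ ↔ x ∈ 𝔨.toSubmoduleᗮ ∧ ∀ η ∈ 𝔩, ⁅η, x⁆ = 0
  /-- the irreducible summands `𝔴₁, …, 𝔴_m` for the adjoint action of `𝔩` -/
  w : Fin m → LieSubmodule ℝ 𝔩 𝔤
  w_irreducible : ∀ j, LieModule.IsIrreducible ℝ 𝔩 (w j)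
  w₀_orthogonal : ∀ j, w₀ ⟂ (w j).toSubmodule
  w_orthogonal : ∀ i j, i ≠ j → (w i).toSubmodule ⟂ (w j).toSubmodule
  w_sum : w₀ ⊔ ⨆ j, (w j).toSubmodule = 𝔨.toSubmoduleᗮ
  /-- the constraint subspace; its orthogonal complement `𝔥` is spanned by the covectors `a^i` -/
  𝔡 : Submodule ℝ 𝔤
  /-- the number of summands `𝔴₁, …, 𝔴_g` met by `𝔡` -/
  g : ℕ
  g_le_m : g ≤ m
  𝔡_sum : 𝔡 = (𝔡 ⊓ 𝔩.toSubmodule) ⊔ (𝔡 ⊓ w₀) ⊔ ⨆ k : Fin g, 𝔡 ⊓ (w (Fin.castLE g_le_m k)).toSubmodule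
  𝔡_inf_w_ne_bot : ∀ k : Fin g, 𝔡 ⊓ (w (Fin.castLE g_le_m k)).toSubmodule ≠ ⊥
  one_le_finrank_u : 1 ≤ Module.finrank ℝ (𝔡 ⊓ 𝔩.toSubmodule : Submodule ℝ 𝔤)
  A : 𝔤 →ₗ[ℝ] 𝔤
  A_symmetric : A.IsSymmetric
  A_posDef : ∀ x, x ≠ 0 → 0 < inner ℝ (A x) x
  s : ℝ
  A_u : ∀ x ∈ 𝔡 ⊓ 𝔩.toSubmodule, A x = s • x
  A_d₀ : ∀ x ∈ 𝔡 ⊓ w₀, A x ∈ 𝔡 ⊓ w₀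
  A_d : ∀ k : Fin g, ∀ x ∈ 𝔡 ⊓ (w (Fin.castLE g_le_m k)).toSubmodule,
    A x ∈ 𝔡 ⊓ (w (Fin.castLE g_le_m k)).toSubmodule

namespace EPSData

variable {𝔤 : Type*} [NormedLieRing 𝔤] [InvariantInnerLieAlgebra 𝔤] (S : EPSData 𝔤)

/-- `𝔲 = 𝔡 ∩ 𝔩`. -/
def u : Submodule ℝ 𝔤 := S.𝔡 ⊓ S.𝔩.toSubmodule

/-- `𝔡₀ = 𝔡 ∩ 𝔴₀`. -/
def d₀ : Submodule ℝ 𝔤 := S.𝔡 ⊓ S.w₀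

/-- `𝔡_k = 𝔡 ∩ 𝔴_k`, `k = 1, …, g`. -/
def d (k : Fin S.g) : Submodule ℝ 𝔤 := S.𝔡 ⊓ (S.w (Fin.castLE S.g_le_m k)).toSubmodule

/-- `A - s · Id`, which on `𝔡_k` is the operator `B_k = A_k - s · Id_k`. -/
def B : 𝔤 →ₗ[ℝ] 𝔤 := S.A - S.s • LinearMap.id

/-- `B_k` is positive definite. -/
def BPosDef (k : Fin S.g) : Prop := ∀ ξ ∈ S.d k, ξ ≠ 0 → 0 < inner ℝ (S.B ξ) ξ

/-- The values of the quadratic form of `B_k` on the unit sphere of `𝔡_k`. -/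
def unitValues (k : Fin S.g) : Set ℝ := {r | ∃ ξ ∈ S.d k, ‖ξ‖ = 1 ∧ r = inner ℝ (S.B ξ) ξ}

/-- `F_k(x) = ⟨B_k x_k, x_k⟩`, where `x_k` is the orthogonal projection of `x` to `𝔡_k`. -/
noncomputable def F [FiniteDimensional ℝ 𝔤] (k : Fin S.g) (x : 𝔤) : ℝ :=
  inner ℝ (S.B ((S.d k).starProjection x)) ((S.d k).starProjection x)

/-- The common level set `x₀ = c₀`, `F_k = c_k` (`k = 1, …, g`), `⟨x, x⟩ = c_{g+1}` in `𝔡`. -/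
def levelSet [FiniteDimensional ℝ 𝔤] (c₀ : 𝔤) (c : Fin S.g → ℝ) (c' : ℝ) : Set 𝔤 :=
  {x | x ∈ S.𝔡 ∧ S.d₀.starProjection x = c₀ ∧ (∀ k, S.F k x = c k) ∧ inner ℝ x x = c'}

/-- `x` solves the Euler–Poincaré–Suslov equations `ẋ = [x, A x] + ∑ λ_i a^i`, `x ∈ 𝔡`, for times in
`I`, the `λ_i` being Lagrange multipliers and the `a^i` spanning `𝔥 = 𝔡ᗮ`.
As `A` preserves `𝔡`, for open `I` this says `x ∈ 𝔡` and `ẋ = [x, A x]_𝔡`. -/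
def IsSolutionOn (x : ℝ → 𝔤) (I : Set ℝ) : Prop :=
  ∀ t ∈ I, x t ∈ S.𝔡 ∧ ∃ v : 𝔤, HasDerivAt x v t ∧ v - ⁅x t, S.A (x t)⁆ ∈ S.𝔡ᗮ

/-- `M` is the disjoint union of `N` tori of dimension `r`, with angular coordinates `φ` in which
the Euler–Poincaré–Suslov equations read `φ̇_i = Ω_i / Φ(φ)`, where the `Ω_i` are constants and
`Φ` is a smooth positive function, `2π`-periodic in each variable. -/
def IsUnionOfTori (M : Set 𝔤) (N r : ℕ) : Prop :=
  ∃ (T : Fin N → Set 𝔤) (Ω : Fin r → ℝ),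
    M = ⋃ j, T j ∧ (∀ i j, i ≠ j → Disjoint (T i) (T j)) ∧
    ∀ j, ∃ (f : (Fin r → ℂ) → 𝔤) (f' : 𝔤 → (Fin r → ℂ)) (Φ : (Fin r → ℝ) → ℝ),
      IsDiffeoOn f f' (stdTorus r) (T j) ∧
      ContDiff ℝ ∞ Φ ∧ (∀ φ, 0 < Φ φ) ∧
      (∀ φ (i : Fin r), Φ (φ + Pi.single i (2 * Real.pi)) = Φ φ) ∧
      ∀ (I : Set ℝ) (φ : ℝ → Fin r → ℝ), IsOpen I → DifferentiableOn ℝ φ I →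
        (S.IsSolutionOn (fun t => f (torusPoint (φ t))) I ↔
          ∀ t ∈ I, HasDerivAt φ (fun i => Ω i / Φ (φ t)) t)

end EPSData

/-! Write `x = y + x₀ + ∑ X_k` with `y ∈ 𝔲`, `x₀ ∈ 𝔡₀`, `X_k ∈ 𝔡_k`. Since `[x, x] = 0`, the
operator `A` in `[x, A x]` may be replaced by `B = A - s`, which vanishes on `𝔲`. The bracket then
splits into a part in `𝔨`, coming from two vectors of `𝔴`, and the terms `[y, B X_k] ∈ 𝔴_k`; the
term `[y, B x₀]` is zero (`lie_A_decomp`). Projection to `𝔡` gives `ẋ₀ = 0` and `Ẋ_k = [y, B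
X_k]_{𝔡_k}`. By ad-invariance `[y, B X_k]` is orthogonal to `B X_k` and `[x, A x]` to `x`, so `x₀`,
the `F_k` and `F` are conserved.

When the `B_k` are positive definite, the `X_k` run independently over the ellipsoids `⟨B X_k, X_k⟩
= c_k`, where `‖X_k‖² ≤ c_k / b_k`. The bound on `c_{g+1}` therefore keeps `‖y‖² = c_{g+1} - ‖c₀‖² -
∑ ‖X_k‖²` positive (`radius_pos`), and `y` runs over a sphere whose radius depends smoothly on the
`X_k`. Normalizing every component gives the product of spheres.

If `𝔲 = ℝ e`, then `y = σ ρ e` with a sign `σ` and `ρ > 0` a function of the `X_k`. On a plane `𝔡_k`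
the map `X ↦ [e, B X]_{𝔡_k}` is infinitesimally skew for the form of `B`, hence a rotation with
constant velocity `ν_k` in conjugate semi-axes of the ellipse; on a line it is zero
(`EllipseFrame`). With angles oriented by `σ` the equations become `φ̇_k = ν_k ρ`, so `Φ = 1 / ρ`.
The equation for `y` follows from conservation of the norm (`sub_lie_mem_orthogonal_iff`). The signs
of `y` and of the `X_k` on lines label the tori. -/

namespace EPSData

variable {𝔤 : Type*} [NormedLieRing 𝔤] [InvariantInnerLieAlgebra 𝔤] (S : EPSData 𝔤)

/-! ### Orthogonal splitting of `𝔡` and its projections. -/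

theorem w₀_le : S.w₀ ≤ S.𝔨.toSubmoduleᗮ := by
  rw [← S.w_sum]; exact le_sup_left

theorem w_le (j : Fin S.m) : (S.w j).toSubmodule ≤ S.𝔨.toSubmoduleᗮ := by
  rw [← S.w_sum]; exact (le_iSup (fun j => (S.w j).toSubmodule) j).trans le_sup_right

theorem u_le_k : S.u ≤ S.𝔨.toSubmodule := inf_le_right.trans S.𝔩_le_𝔨

theorem d₀_le : S.d₀ ≤ S.𝔨.toSubmoduleᗮ := inf_le_right.trans S.w₀_le

theorem d_le (k : Fin S.g) : S.d k ≤ S.𝔨.toSubmoduleᗮ := inf_le_right.trans (S.w_le _)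

theorem inner_k {x y : 𝔤} (hx : x ∈ S.𝔨) (hy : y ∈ S.𝔨.toSubmoduleᗮ) : inner ℝ x y = 0 :=
  Submodule.inner_right_of_mem_orthogonal (K := S.𝔨.toSubmodule) hx hy

theorem inner_u_d₀ {x y : 𝔤} (hx : x ∈ S.u) (hy : y ∈ S.d₀) : inner ℝ x y = 0 :=
  S.inner_k (S.u_le_k hx) (S.d₀_le hy)

theorem inner_u_d {k} {x y : 𝔤} (hx : x ∈ S.u) (hy : y ∈ S.d k) : inner ℝ x y = 0 :=
  S.inner_k (S.u_le_k hx) (S.d_le k hy)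

theorem inner_d₀_d {k} {x y : 𝔤} (hx : x ∈ S.d₀) (hy : y ∈ S.d k) : inner ℝ x y = 0 :=
  (Submodule.isOrtho_iff_inner_eq.1 (S.w₀_orthogonal _)) x hx.2 y hy.2

theorem inner_d_d {j k} (h : j ≠ k) {x y : 𝔤} (hx : x ∈ S.d j) (hy : y ∈ S.d k) :
    inner ℝ x y = 0 :=
  (Submodule.isOrtho_iff_inner_eq.1 (S.w_orthogonal _ _
    (fun e => h (Fin.castLE_injective _ e)))) x hx.2 y hy.2

theorem A_inner (x y : 𝔤) : inner ℝ (S.A x) y = inner ℝ x (S.A y) := S.A_symmetric x y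

theorem B_apply (x : 𝔤) : S.B x = S.A x - S.s • x := rfl

theorem B_inner (x y : 𝔤) : inner ℝ (S.B x) y = inner ℝ x (S.B y) := by
  simp only [B_apply, inner_sub_left, inner_sub_right, A_inner, inner_smul_left, inner_smul_right]
  simp

theorem B_u {x : 𝔤} (hx : x ∈ S.u) : S.B x = 0 := by
  rw [B_apply, S.A_u x hx, sub_self]

theorem B_d₀ {x : 𝔤} (hx : x ∈ S.d₀) : S.B x ∈ S.d₀ :=
  sub_mem (S.A_d₀ x hx) (Submodule.smul_mem _ _ hx)

theorem B_d {k} {x : 𝔤} (hx : x ∈ S.d k) : S.B x ∈ S.d k :=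
  sub_mem (S.A_d k x hx) (Submodule.smul_mem _ _ hx)

/-- A multiple of `x` commutes with `x`. The gain is that `B` kills `𝔲`, which `A` does not. -/
theorem lie_A (x : 𝔤) : ⁅x, S.A x⁆ = ⁅x, S.B x⁆ := by
  rw [B_apply, lie_sub, lie_smul, lie_self, smul_zero, sub_zero]

theorem inner_lie_self (x y : 𝔤) : inner ℝ x ⁅x, y⁆ = 0 := by
  rw [← InvariantInnerLieAlgebra.inner_lie, lie_self, inner_zero_left]

theorem inner_lie_right (x y : 𝔤) : inner ℝ y ⁅x, y⁆ = 0 := by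
  rw [← lie_skew, inner_neg_right, inner_lie_self, neg_zero]

theorem exists_decomp {x : 𝔤} (hx : x ∈ S.𝔡) :
    ∃ y ∈ S.u, ∃ x₀ ∈ S.d₀, ∃ X : Fin S.g → 𝔤, (∀ k, X k ∈ S.d k) ∧ x = y + x₀ + ∑ k, X k := by
  rw [S.𝔡_sum, Submodule.mem_sup] at hx
  obtain ⟨a, ha, b, hb, rfl⟩ := hx
  obtain ⟨y, hy, x₀, hx₀, rfl⟩ := Submodule.mem_sup.1 ha
  obtain ⟨X, hX, rfl⟩ := (Submodule.mem_iSup_iff_exists_finsupp _ _).1 hb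
  refine ⟨y, hy, x₀, hx₀, X, hX, ?_⟩
  rw [Finsupp.sum_fintype _ _ (fun _ => rfl)]

/-- The vector of `𝔡` with given components. -/
theorem decomp_mem {y x₀ : 𝔤} {X : Fin S.g → 𝔤} (hy : y ∈ S.u) (h₀ : x₀ ∈ S.d₀)
    (hX : ∀ k, X k ∈ S.d k) : y + x₀ + ∑ k, X k ∈ S.𝔡 :=
  add_mem (add_mem hy.1 h₀.1) (sum_mem fun k _ => (hX k).1)

/-- Cross terms vanish because `𝔲 ⊆ 𝔨`, the other summands lie in `𝔨ᗮ`, and these are mutually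
orthogonal. Pairing with vectors having a single nonzero component then yields the projections. -/
theorem inner_decomp {y x₀ y' x₀' : 𝔤} {X X' : Fin S.g → 𝔤} (hy : y ∈ S.u) (h₀ : x₀ ∈ S.d₀)
    (hX : ∀ k, X k ∈ S.d k) (hy' : y' ∈ S.u) (h₀' : x₀' ∈ S.d₀)
    (hX' : ∀ k, X' k ∈ S.d k) :
    inner ℝ (y + x₀ + ∑ k, X k) (y' + x₀' + ∑ k, X' k) =
      inner ℝ y y' + inner ℝ x₀ x₀' + ∑ k, inner ℝ (X k) (X' k) := by
  have h1 : ∀ k, inner ℝ (X k) (∑ j, X' j) = inner ℝ (X k) (X' k) := fun k => by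
    rw [inner_sum]
    exact Finset.sum_eq_single k (fun j _ hj => S.inner_d_d hj.symm (hX k) (hX' j)) (by simp)
  have h2 : inner ℝ y (∑ j, X' j) = 0 := by
    rw [inner_sum]; exact Finset.sum_eq_zero fun j _ => S.inner_u_d hy (hX' j)
  have h3 : inner ℝ x₀ (∑ j, X' j) = 0 := by
    rw [inner_sum]; exact Finset.sum_eq_zero fun j _ => S.inner_d₀_d h₀ (hX' j)
  have h4 : ∀ k, inner ℝ (X k) (y' + x₀') = 0 := fun k => by
    rw [inner_add_right, real_inner_comm, S.inner_u_d hy' (hX k), real_inner_comm,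
      S.inner_d₀_d h₀' (hX k), add_zero]
  rw [inner_add_left, inner_add_left, sum_inner]
  simp only [inner_add_right (X _) (y' + x₀'), h1, h4, zero_add]
  rw [inner_add_right y, inner_add_right x₀, h2, h3, inner_add_right, inner_add_right,
    S.inner_u_d₀ hy h₀', real_inner_comm y' x₀, S.inner_u_d₀ hy' h₀]
  ring

section Proj

variable [FiniteDimensional ℝ 𝔤]

theorem starProjection_d_decomp {y x₀ : 𝔤} {X : Fin S.g → 𝔤} (hy : y ∈ S.u) (h₀ : x₀ ∈ S.d₀)
    (hX : ∀ k, X k ∈ S.d k) (k : Fin S.g) :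
    (S.d k).starProjection (y + x₀ + ∑ k, X k) = X k := by
  refine Submodule.eq_starProjection_of_mem_of_inner_eq_zero (hX k) fun w hw => ?_
  have h := S.inner_decomp (y' := 0) (x₀' := 0) (X' := Pi.single k w) hy h₀ hX (zero_mem _)
    (zero_mem _) (fun j => by
      rcases eq_or_ne j k with rfl | hj
      · simpa using hw
      · simp [Pi.single_eq_of_ne hj])
  have h' : ∑ j, inner ℝ (X j) ((Pi.single k w : Fin S.g → 𝔤) j) = inner ℝ (X k) w := by
    rw [Finset.sum_eq_single k (fun j _ hj => by simp [Pi.single_eq_of_ne hj]) (by simp)]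
    simp
  rw [h', Finset.sum_pi_single'] at h
  simp at h
  rw [inner_sub_left, h, sub_self]

theorem starProjection_d₀_decomp {y x₀ : 𝔤} {X : Fin S.g → 𝔤} (hy : y ∈ S.u) (h₀ : x₀ ∈ S.d₀)
    (hX : ∀ k, X k ∈ S.d k) : S.d₀.starProjection (y + x₀ + ∑ k, X k) = x₀ := by
  refine Submodule.eq_starProjection_of_mem_of_inner_eq_zero h₀ fun w hw => ?_
  have h := S.inner_decomp (y' := 0) (x₀' := w) (X' := 0) hy h₀ hX (zero_mem _) hw
    (fun _ => zero_mem _)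
  simp at h
  rw [inner_sub_left, h, sub_self]

theorem starProjection_u_decomp {y x₀ : 𝔤} {X : Fin S.g → 𝔤} (hy : y ∈ S.u) (h₀ : x₀ ∈ S.d₀)
    (hX : ∀ k, X k ∈ S.d k) : S.u.starProjection (y + x₀ + ∑ k, X k) = y := by
  refine Submodule.eq_starProjection_of_mem_of_inner_eq_zero hy fun w hw => ?_
  have h := S.inner_decomp (y' := w) (x₀' := 0) (X' := 0) hy h₀ hX hw (zero_mem _)
    (fun _ => zero_mem _)
  simp at h
  rw [inner_sub_left, h, sub_self]

theorem F_decomp {y x₀ : 𝔤} {X : Fin S.g → 𝔤} (hy : y ∈ S.u) (h₀ : x₀ ∈ S.d₀)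
    (hX : ∀ k, X k ∈ S.d k) (k : Fin S.g) :
    S.F k (y + x₀ + ∑ k, X k) = inner ℝ (S.B (X k)) (X k) := by
  rw [F, S.starProjection_d_decomp hy h₀ hX]

theorem decomp_mem_levelSet {c₀ : 𝔤} (hc₀ : c₀ ∈ S.d₀) {c : Fin S.g → ℝ} {c' : ℝ} {y : 𝔤}
    {X : Fin S.g → 𝔤} (hy : y ∈ S.u) (hX : ∀ k, X k ∈ S.d k) :
    y + c₀ + ∑ k, X k ∈ S.levelSet c₀ c c' ↔
      (∀ k, inner ℝ (S.B (X k)) (X k) = c k) ∧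
        ‖y‖ ^ 2 = c' - ‖c₀‖ ^ 2 - ∑ k, ‖X k‖ ^ 2 := by
  simp only [levelSet, Set.mem_ofPred_eq, S.F_decomp hy hc₀ hX,
    S.starProjection_d₀_decomp hy hc₀ hX, S.decomp_mem hy hc₀ hX, true_and,
    S.inner_decomp hy hc₀ hX hy hc₀ hX]
  simp only [real_inner_self_eq_norm_sq]
  refine and_congr_right fun _ => ⟨fun h => ?_, fun h => ?_⟩ <;> linarith

/-- An element of the level set is determined by its components in `𝔲` and the `𝔡_k`. -/
theorem exists_of_mem_levelSet {c₀ : 𝔤} {c : Fin S.g → ℝ} {c' : ℝ} {x : 𝔤}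
    (hx : x ∈ S.levelSet c₀ c c') :
    ∃ y ∈ S.u, ∃ X : Fin S.g → 𝔤, (∀ k, X k ∈ S.d k) ∧ x = y + c₀ + ∑ k, X k := by
  obtain ⟨y, hy, x₀, hx₀, X, hX, rfl⟩ := S.exists_decomp hx.1
  have h := hx.2.1
  rw [S.starProjection_d₀_decomp hy hx₀ hX] at h
  exact ⟨y, hy, X, hX, by rw [h]⟩

end Proj

/-! ### The bracket `[x, A x]` in components. -/

/-- The part of the bracket free of `y` is a bracket of two elements of `𝔨ᗮ`, hence lies in `𝔨` and
is invisible to `𝔡₀` and the `𝔡_k`. Of the terms with `y`, the one with `B x₀` vanishes because `𝔩`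
acts trivially on `𝔴₀`. -/
theorem lie_A_decomp {y x₀ : 𝔤} {X : Fin S.g → 𝔤} (hy : y ∈ S.u) (h₀ : x₀ ∈ S.d₀)
    (hX : ∀ k, X k ∈ S.d k) :
    ∃ η ∈ S.𝔨, ⁅y + x₀ + ∑ k, X k, S.A (y + x₀ + ∑ k, X k)⁆ = η + ∑ k, ⁅y, S.B (X k)⁆ := by
  refine ⟨⁅x₀ + ∑ k, X k, S.B (x₀ + ∑ k, X k)⁆, ?_, ?_⟩
  · refine S.symmetricPair.lie_perp_perp _ (add_mem (S.d₀_le h₀) (sum_mem fun k _ => S.d_le k (hX k)))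
      _ ?_
    rw [map_add, map_sum]
    exact add_mem (S.d₀_le (S.B_d₀ h₀)) (sum_mem fun k _ => S.d_le k (S.B_d (hX k)))
  · have h : ⁅y, S.B x₀⁆ = 0 := ((S.mem_w₀ _).1 (S.B_d₀ h₀).2).2 y hy.2
    rw [lie_A, add_assoc, map_add S.B y, S.B_u hy, zero_add, add_lie, add_comm, map_add, map_sum,
      lie_add y, h, zero_add, lie_sum]

/-- The pairing of `[x, A x]` with `𝔡_k` in components. -/
theorem inner_lie_d {y x₀ : 𝔤} {X : Fin S.g → 𝔤} (hy : y ∈ S.u) (h₀ : x₀ ∈ S.d₀)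
    (hX : ∀ k, X k ∈ S.d k) {k : Fin S.g} {w : 𝔤} (hw : w ∈ S.d k) :
    inner ℝ ⁅y + x₀ + ∑ k, X k, S.A (y + x₀ + ∑ k, X k)⁆ w = inner ℝ ⁅y, S.B (X k)⁆ w := by
  obtain ⟨η, hη, h⟩ := S.lie_A_decomp hy h₀ hX
  rw [h, inner_add_left, S.inner_k hη (S.d_le k hw), zero_add, sum_inner]
  refine Finset.sum_eq_single k (fun j _ hj => ?_) (by simp)
  -- The vector `[y, B X_j]` may leave `𝔡_j`, but it stays in the `𝔩`-module `𝔴_j`, which is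
  -- orthogonal to `𝔴_k`.
  exact (Submodule.isOrtho_iff_inner_eq.1 (S.w_orthogonal _ _
    (fun e => hj (Fin.castLE_injective _ e)))) _
    ((S.w (Fin.castLE S.g_le_m j)).lie_mem (x := (⟨y, hy.2⟩ : S.𝔩)) (S.B_d (hX j)).2) w hw.2

/-- `[x, A x]` is orthogonal to `𝔡₀`. -/
theorem inner_lie_d₀ {y x₀ : 𝔤} {X : Fin S.g → 𝔤} (hy : y ∈ S.u) (h₀ : x₀ ∈ S.d₀)
    (hX : ∀ k, X k ∈ S.d k) {w : 𝔤} (hw : w ∈ S.d₀) :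
    inner ℝ ⁅y + x₀ + ∑ k, X k, S.A (y + x₀ + ∑ k, X k)⁆ w = 0 := by
  obtain ⟨η, hη, h⟩ := S.lie_A_decomp hy h₀ hX
  have hyw : ⁅y, w⁆ = 0 := ((S.mem_w₀ _).1 hw.2).2 y hy.2
  rw [h, inner_add_left, S.inner_k hη (S.d₀_le hw), zero_add, sum_inner]
  refine Finset.sum_eq_zero fun j _ => ?_
  -- Ad-invariance moves `y` onto `w`, on which it acts by zero.
  rw [← lie_skew, inner_neg_left, InvariantInnerLieAlgebra.inner_lie, hyw, inner_zero_right,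
    neg_zero]

/-! ### Conserved quantities. -/

theorem eq_of_hasDerivAt_zero {E : Type*} [NormedAddCommGroup E] [NormedSpace ℝ E] {I : Set ℝ}
    (hI : IsOpen I) (hc : I.OrdConnected) {f : ℝ → E} (hf : ∀ t ∈ I, HasDerivAt f 0 t) {t₀ t : ℝ}
    (h₀ : t₀ ∈ I) (ht : t ∈ I) : f t = f t₀ :=
  hI.is_const_of_deriv_eq_zero hc.isPreconnected
    (fun t ht => (hf t ht).differentiableAt.differentiableWithinAt)
    (fun t ht => (hf t ht).deriv) ht h₀

theorem hasDerivAt_inner_self {x : ℝ → 𝔤} {v : 𝔤} {t : ℝ} (hx : x t ∈ S.𝔡)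
    (hv : HasDerivAt x v t) (hv' : v - ⁅x t, S.A (x t)⁆ ∈ S.𝔡ᗮ) :
    HasDerivAt (fun t => inner ℝ (x t) (x t)) 0 t := by
  have h1 := Submodule.inner_right_of_mem_orthogonal (K := S.𝔡) (u := x t) hx hv'
  rw [inner_sub_right, inner_lie_self, sub_zero] at h1
  refine (hv.inner ℝ hv).congr_deriv ?_
  rw [real_inner_comm (x t) v, h1, add_zero]

section Invariance

variable [FiniteDimensional ℝ 𝔤]

theorem hasDerivAt_starProjection_d₀ {x : ℝ → 𝔤} {v : 𝔤} {t : ℝ} (hx : x t ∈ S.𝔡)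
    (hv : HasDerivAt x v t) (hv' : v - ⁅x t, S.A (x t)⁆ ∈ S.𝔡ᗮ) :
    HasDerivAt (fun t => S.d₀.starProjection (x t)) 0 t := by
  have h := S.d₀.starProjection.hasFDerivAt.comp_hasDerivAt t hv
  refine h.congr_deriv
    (Submodule.eq_starProjection_of_mem_of_inner_eq_zero (K := S.d₀) (zero_mem _) fun w hw => ?_)
  obtain ⟨y, hy, x₀, hx₀, X, hX, e⟩ := S.exists_decomp hx
  have h1 := Submodule.inner_left_of_mem_orthogonal (K := S.𝔡) (u := w) hw.1 hv'
  rw [inner_sub_left, e, S.inner_lie_d₀ hy hx₀ hX hw] at h1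
  simpa using h1

/-- Since `B` is symmetric, the derivative is `2⟨B X_k, v⟩`. As `B X_k` lies in `𝔡_k`, it sees only
`[y, B X_k]` in `v`, and this is orthogonal to `B X_k`. -/
theorem hasDerivAt_F {x : ℝ → 𝔤} {v : 𝔤} {t : ℝ} (hx : x t ∈ S.𝔡)
    (hv : HasDerivAt x v t) (hv' : v - ⁅x t, S.A (x t)⁆ ∈ S.𝔡ᗮ) (k : Fin S.g) :
    HasDerivAt (fun t => S.F k (x t)) 0 t := by
  have h := (S.d k).starProjection.hasFDerivAt.comp_hasDerivAt t hv
  have hB := (LinearMap.toContinuousLinearMap S.B).hasFDerivAt.comp_hasDerivAt t h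
  have h2 := hB.inner ℝ h
  refine h2.congr_deriv ?_
  obtain ⟨y, hy, x₀, hx₀, X, hX, e⟩ := S.exists_decomp hx
  have hw := S.B_d (hX k)
  have h1 := Submodule.inner_left_of_mem_orthogonal (K := S.𝔡) (u := S.B (X k)) hw.1 hv'
  rw [inner_sub_left, e, S.inner_lie_d hy hx₀ hX hw, real_inner_comm _ ⁅y, _⁆,
    inner_lie_right, sub_zero] at h1
  have h3 : inner ℝ (S.B (X k)) ((S.d k).starProjection v) = 0 := by
    rw [← Submodule.inner_starProjection_left_eq_right,
      Submodule.starProjection_eq_self_iff.2 hw, real_inner_comm, h1]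
  have h4 : (S.d k).starProjection (x t) = X k := by
    rw [e, S.starProjection_d_decomp hy hx₀ hX]
  simp only [Function.comp, LinearMap.coe_toContinuousLinearMap', h4, h3, B_inner]
  rw [zero_add, real_inner_comm, h3]

/-- The level sets are invariant under the Euler–Poincaré–Suslov equations. -/
theorem levelSet_invariant {c₀ : 𝔤} {c : Fin S.g → ℝ} {c' : ℝ} {I : Set ℝ} {x : ℝ → 𝔤}
    (hI : IsOpen I) (hc : I.OrdConnected) (hx : S.IsSolutionOn x I) {t₀ t : ℝ} (h₀ : t₀ ∈ I)
    (ht : t ∈ I) (hM : x t₀ ∈ S.levelSet c₀ c c') : x t ∈ S.levelSet c₀ c c' := by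
  refine ⟨(hx t ht).1, ?_, fun k => ?_, ?_⟩
  · rw [← hM.2.1]
    refine eq_of_hasDerivAt_zero (f := fun t => S.d₀.starProjection (x t)) hI hc (fun t ht => ?_)
      h₀ ht
    obtain ⟨hd, v, hv, hv'⟩ := hx t ht
    exact S.hasDerivAt_starProjection_d₀ hd hv hv'
  · rw [← hM.2.2.1 k]
    refine eq_of_hasDerivAt_zero (f := fun t => S.F k (x t)) hI hc (fun t ht => ?_) h₀ ht
    obtain ⟨hd, v, hv, hv'⟩ := hx t ht
    exact S.hasDerivAt_F hd hv hv' k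
  · rw [← hM.2.2.2]
    refine eq_of_hasDerivAt_zero (f := fun t => inner ℝ (x t) (x t)) hI hc (fun t ht => ?_) h₀ ht
    obtain ⟨hd, v, hv, hv'⟩ := hx t ht
    exact S.hasDerivAt_inner_self hd hv hv'

end Invariance

/-- If `𝔲` is a line on which `x` has nonzero component, a vector `v` tangent to the sphere is the
Euler–Poincaré–Suslov vector at `x` as soon as its components in the `𝔡_k` are. -/
theorem sub_lie_mem_orthogonal_iff {y x₀ v₁ : 𝔤} {X V : Fin S.g → 𝔤} (hy : y ∈ S.u)
    (h₀ : x₀ ∈ S.d₀) (hX : ∀ k, X k ∈ S.d k) (hu : ∀ z ∈ S.u, ∃ a : ℝ, z = a • y)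
    (hv₁ : v₁ ∈ S.u) (hV : ∀ k, V k ∈ S.d k)
    (hxv : inner ℝ (y + x₀ + ∑ k, X k) (v₁ + ∑ k, V k) = 0) :
    v₁ + ∑ k, V k - ⁅y + x₀ + ∑ k, X k, S.A (y + x₀ + ∑ k, X k)⁆ ∈ S.𝔡ᗮ ↔
      ∀ k, ∀ w ∈ S.d k, inner ℝ (V k) w = inner ℝ ⁅y, S.B (X k)⁆ w := by
  have hvk : ∀ k, ∀ w ∈ S.d k, inner ℝ (v₁ + ∑ k, V k) w = inner ℝ (V k) w := by
    intro k w hw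
    rw [inner_add_left, S.inner_u_d hv₁ hw, zero_add, sum_inner]
    exact Finset.sum_eq_single k (fun j _ hj => S.inner_d_d hj (hV j) hw) (by simp)
  have hv0 : ∀ w ∈ S.d₀, inner ℝ (v₁ + ∑ k, V k) w = 0 := by
    intro w hw
    rw [inner_add_left, S.inner_u_d₀ hv₁ hw, zero_add, sum_inner]
    exact Finset.sum_eq_zero fun j _ => by rw [real_inner_comm, S.inner_d₀_d hw (hV j)]
  set v := v₁ + ∑ k, V k with hv
  set x := y + x₀ + ∑ k, X k with hx
  have hD0 : ∀ w ∈ S.d₀, inner ℝ (v - ⁅x, S.A x⁆) w = 0 := fun w hw => by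
    rw [inner_sub_left, hv0 w hw, S.inner_lie_d₀ hy h₀ hX hw, sub_zero]
  have hDk : ∀ k, ∀ w ∈ S.d k, inner ℝ (v - ⁅x, S.A x⁆) w =
      inner ℝ (V k) w - inner ℝ ⁅y, S.B (X k)⁆ w := fun k w hw => by
    rw [inner_sub_left, hvk k w hw, S.inner_lie_d hy h₀ hX hw]
  constructor
  · intro h k w hw
    have := Submodule.inner_left_of_mem_orthogonal (K := S.𝔡) (u := w) hw.1 h
    rw [hDk k w hw] at this
    linarith
  · intro h
    have hDk' : ∀ k, ∀ w ∈ S.d k, inner ℝ (v - ⁅x, S.A x⁆) w = 0 := fun k w hw => by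
      rw [hDk k w hw, h k w hw, sub_self]
    -- Along `𝔲` nothing is computed: the defect `v - [x, A x]` is orthogonal to `x`, to `x₀` and to
    -- every `X_k`, hence to the remaining component `y`, which spans `𝔲`.
    have hDx : inner ℝ (v - ⁅x, S.A x⁆) x = 0 := by
      rw [real_inner_comm, inner_sub_right, inner_lie_self, hxv, sub_zero]
    have hDy : inner ℝ (v - ⁅x, S.A x⁆) y = 0 := by
      have e : y = x - x₀ - ∑ k, X k := by rw [hx]; abel
      rw [e, inner_sub_right, inner_sub_right, hDx, hD0 _ h₀, inner_sum,
        Finset.sum_eq_zero fun k _ => hDk' k _ (hX k)]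
      simp
    rw [Submodule.mem_orthogonal']
    intro w hw
    obtain ⟨z, hz, w₀, hw₀, W, hW, rfl⟩ := S.exists_decomp hw
    obtain ⟨a, rfl⟩ := hu z hz
    rw [inner_add_right, inner_add_right, inner_smul_right, hDy, hD0 _ hw₀, inner_sum,
      Finset.sum_eq_zero fun k _ => hDk' k _ (hW k)]
    simp

end EPSData

/-! ### The level set as a product of spheres. -/

theorem smoothOnSubset_of_eventually {E F : Type*} [NormedAddCommGroup E] [NormedSpace ℝ E]
    [NormedAddCommGroup F] [NormedSpace ℝ F] {f : E → F} {X : Set E}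
    (h : ∀ x ∈ X, ∀ᶠ y in nhds x, ContDiffAt ℝ ∞ f y) : SmoothOnSubset f X := by
  intro x hx
  obtain ⟨U, hU, hUo, hxU⟩ := eventually_nhds_iff.1 (h x hx)
  exact ⟨U, hUo, hxU, f, fun y hy => (hU y hy).contDiffWithinAt, fun _ _ => rfl⟩

namespace EPSData

variable {𝔤 : Type*} [NormedLieRing 𝔤] [InvariantInnerLieAlgebra 𝔤] (S : EPSData 𝔤)

/-- The bound `‖ξ‖² ≤ ⟨B_k ξ, ξ⟩ / b_k`. -/
theorem norm_sq_le_of_isLeast {k : Fin S.g} {b : ℝ} (hB : S.BPosDef k)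
    (hb : IsLeast (S.unitValues k) b) {ξ : 𝔤} (hξ : ξ ∈ S.d k) :
    ‖ξ‖ ^ 2 ≤ inner ℝ (S.B ξ) ξ / b := by
  have hb0 : 0 < b := by
    obtain ⟨η, hη, h1, rfl⟩ := hb.1
    exact hB η hη (by rintro rfl; simp at h1)
  rw [le_div_iff₀ hb0]
  rcases eq_or_ne ξ 0 with rfl | h0
  · simp
  have hn : ‖ξ‖ ≠ 0 := norm_ne_zero_iff.2 h0
  have h := hb.2 ⟨‖ξ‖⁻¹ • ξ, Submodule.smul_mem _ _ hξ, by
    rw [norm_smul, norm_inv, norm_norm, inv_mul_cancel₀ hn], rfl⟩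
  rw [map_smul, inner_smul_left, inner_smul_right] at h
  simp only [conj_trivial] at h
  have h2 : 0 ≤ ‖ξ‖ ^ 2 := by positivity
  calc ‖ξ‖ ^ 2 * b ≤ ‖ξ‖ ^ 2 * (‖ξ‖⁻¹ * (‖ξ‖⁻¹ * inner ℝ (S.B ξ) ξ)) :=
        mul_le_mul_of_nonneg_left h h2
    _ = inner ℝ (S.B ξ) ξ := by field_simp

/-- This is where the bound on `c'` enters: the `𝔲`-component of a point of the level set never
vanishes, so its direction is defined and the square root giving its length is smooth. -/
theorem radius_pos {c₀ : 𝔤} {c b : Fin S.g → ℝ} {c' : ℝ} (hB : ∀ k, S.BPosDef k)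
    (hb : ∀ k, IsLeast (S.unitValues k) (b k)) (hc : ‖c₀‖ ^ 2 + ∑ k, c k / b k < c')
    {X : Fin S.g → 𝔤} (hX : ∀ k, X k ∈ S.d k) (hXc : ∀ k, inner ℝ (S.B (X k)) (X k) = c k) :
    0 < c' - ‖c₀‖ ^ 2 - ∑ k, ‖X k‖ ^ 2 := by
  have h : ∑ k, ‖X k‖ ^ 2 ≤ ∑ k, c k / b k := Finset.sum_le_sum fun k _ => by
    rw [← hXc k]; exact S.norm_sq_le_of_isLeast (hB k) (hb k) (hX k)
  linarith

section Euclidean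

variable [FiniteDimensional ℝ 𝔤]

/-- Isometric coordinates on a subspace, precomposed with the orthogonal projection. -/
noncomputable def toEuclidean (K : Submodule ℝ 𝔤) :
    𝔤 →L[ℝ] EuclideanSpace ℝ (Fin (Module.finrank ℝ K)) :=
  ((stdOrthonormalBasis ℝ K).repr.toContinuousLinearEquiv :
    K →L[ℝ] EuclideanSpace ℝ (Fin (Module.finrank ℝ K))) ∘L K.orthogonalProjectionOnto

/-- The isometric embedding of a Euclidean space onto a subspace. -/
noncomputable def ofEuclidean (K : Submodule ℝ 𝔤) :
    EuclideanSpace ℝ (Fin (Module.finrank ℝ K)) →L[ℝ] 𝔤 :=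
  K.subtypeL ∘L ((stdOrthonormalBasis ℝ K).repr.symm.toContinuousLinearEquiv :
    EuclideanSpace ℝ (Fin (Module.finrank ℝ K)) →L[ℝ] K)

theorem ofEuclidean_mem (K : Submodule ℝ 𝔤) (ξ) : ofEuclidean K ξ ∈ K := by
  simp [ofEuclidean]

theorem norm_ofEuclidean (K : Submodule ℝ 𝔤) (ξ) : ‖ofEuclidean K ξ‖ = ‖ξ‖ := by
  change ‖(((stdOrthonormalBasis ℝ K).repr.symm ξ : K) : 𝔤)‖ = ‖ξ‖
  rw [← Submodule.coe_norm, LinearIsometryEquiv.norm_map]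

theorem ofEuclidean_toEuclidean (K : Submodule ℝ 𝔤) {x : 𝔤} (hx : x ∈ K) :
    ofEuclidean K (toEuclidean K x) = x := by
  simpa [ofEuclidean, toEuclidean] using Submodule.starProjection_eq_self_iff.2 hx

theorem toEuclidean_ofEuclidean (K : Submodule ℝ 𝔤) (ξ) :
    toEuclidean K (ofEuclidean K ξ) = ξ := by
  simp [ofEuclidean, toEuclidean]

theorem norm_toEuclidean (K : Submodule ℝ 𝔤) {x : 𝔤} (hx : x ∈ K) : ‖toEuclidean K x‖ = ‖x‖ := by
  rw [← norm_ofEuclidean, ofEuclidean_toEuclidean K hx]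

theorem toEuclidean_starProjection (K : Submodule ℝ 𝔤) (x : 𝔤) :
    toEuclidean K (K.starProjection x) = toEuclidean K x := by
  change (stdOrthonormalBasis ℝ K).repr
    (K.orthogonalProjectionOnto (K.orthogonalProjectionOnto x : 𝔤)) = _
  rw [Submodule.orthogonalProjectionOnto_mem_subspace_eq_self]
  rfl

/-- The central projection of a level set to a product of spheres. -/
noncomputable def sphereMap (x : 𝔤) :
    (∀ k, EuclideanSpace ℝ (Fin (Module.finrank ℝ (S.d k)))) ×
      EuclideanSpace ℝ (Fin (Module.finrank ℝ S.u)) :=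
  (fun k => ‖toEuclidean (S.d k) x‖⁻¹ • toEuclidean (S.d k) x,
    ‖toEuclidean S.u x‖⁻¹ • toEuclidean S.u x)

/-- The multiple of the vector with coordinates `ξ` that lies on the ellipsoid `F_k = r`. -/
noncomputable def ellipsoidPoint (k : Fin S.g) (r : ℝ)
    (ξ : EuclideanSpace ℝ (Fin (Module.finrank ℝ (S.d k)))) : 𝔤 :=
  Real.sqrt (r / inner ℝ (S.B (ofEuclidean (S.d k) ξ)) (ofEuclidean (S.d k) ξ)) •
    ofEuclidean (S.d k) ξ

/-- The inverse of `sphereMap` on a level set. -/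
noncomputable def sphereMapInv (c₀ : 𝔤) (c : Fin S.g → ℝ) (c' : ℝ)
    (p : (∀ k, EuclideanSpace ℝ (Fin (Module.finrank ℝ (S.d k)))) ×
      EuclideanSpace ℝ (Fin (Module.finrank ℝ S.u))) : 𝔤 :=
  Real.sqrt (c' - ‖c₀‖ ^ 2 - ∑ k, ‖S.ellipsoidPoint k (c k) (p.1 k)‖ ^ 2) • ofEuclidean S.u p.2
    + c₀ + ∑ k, S.ellipsoidPoint k (c k) (p.1 k)

theorem ellipsoidPoint_mem (k : Fin S.g) (r : ℝ) (ξ) : S.ellipsoidPoint k r ξ ∈ S.d k :=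
  Submodule.smul_mem _ _ (ofEuclidean_mem _ _)

theorem ofEuclidean_ne_zero {K : Submodule ℝ 𝔤} {ξ} (h : ξ ≠ 0) : ofEuclidean K ξ ≠ 0 := by
  rw [← norm_ne_zero_iff, norm_ofEuclidean]; exact norm_ne_zero_iff.2 h

theorem inner_B_ofEuclidean_pos {k : Fin S.g} (hB : S.BPosDef k) {ξ} (h : ξ ≠ 0) :
    0 < inner ℝ (S.B (ofEuclidean (S.d k) ξ)) (ofEuclidean (S.d k) ξ) :=
  hB _ (ofEuclidean_mem _ _) (ofEuclidean_ne_zero h)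

theorem inner_B_ellipsoidPoint {k : Fin S.g} (hB : S.BPosDef k) {r : ℝ} (hr : 0 < r) {ξ}
    (h : ξ ≠ 0) :
    inner ℝ (S.B (S.ellipsoidPoint k r ξ)) (S.ellipsoidPoint k r ξ) = r := by
  have hp := S.inner_B_ofEuclidean_pos hB h
  rw [ellipsoidPoint, map_smul, inner_smul_left, inner_smul_right, conj_trivial, ← mul_assoc,
    Real.mul_self_sqrt (div_pos hr hp).le, div_mul_cancel₀ _ hp.ne']

theorem contDiffAt_ellipsoidPoint {k : Fin S.g} (hB : S.BPosDef k) {r : ℝ} (hr : 0 < r) {ξ}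
    (h : ξ ≠ 0) : ContDiffAt ℝ ∞ (S.ellipsoidPoint k r) ξ := by
  have hp := S.inner_B_ofEuclidean_pos hB h
  have h1 : ContDiffAt ℝ ∞ (fun ξ => ofEuclidean (S.d k) ξ) ξ :=
    (ofEuclidean (S.d k)).contDiff.contDiffAt
  have h2 : ContDiffAt ℝ ∞ (fun ξ => S.B (ofEuclidean (S.d k) ξ)) ξ :=
    ((LinearMap.toContinuousLinearMap S.B) ∘L (ofEuclidean (S.d k))).contDiff.contDiffAt
  exact ((contDiffAt_const.div (h2.inner ℝ h1) hp.ne').sqrt (div_pos hr hp).ne').smul h1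

theorem normalize_norm_eq_one {E : Type*} [NormedAddCommGroup E] [NormedSpace ℝ E] {x : E}
    (h : x ≠ 0) : ‖‖x‖⁻¹ • x‖ = 1 := by
  rw [norm_smul, norm_inv, norm_norm, inv_mul_cancel₀ (norm_ne_zero_iff.2 h)]

theorem inv_norm_smul_smul {E : Type*} [NormedAddCommGroup E] [NormedSpace ℝ E] {x : E} {a : ℝ}
    (ha : 0 < a) (hx : ‖x‖ = 1) : ‖a • x‖⁻¹ • a • x = x := by
  rw [norm_smul, hx, mul_one, Real.norm_of_nonneg ha.le, smul_smul, inv_mul_cancel₀ ha.ne',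
    one_smul]

theorem sphereMap_decomp {y x₀ : 𝔤} {X : Fin S.g → 𝔤} (hy : y ∈ S.u) (h₀ : x₀ ∈ S.d₀)
    (hX : ∀ k, X k ∈ S.d k) :
    S.sphereMap (y + x₀ + ∑ k, X k) =
      (fun k => ‖toEuclidean (S.d k) (X k)‖⁻¹ • toEuclidean (S.d k) (X k),
        ‖toEuclidean S.u y‖⁻¹ • toEuclidean S.u y) := by
  have h1 : ∀ k, toEuclidean (S.d k) (y + x₀ + ∑ k, X k) = toEuclidean (S.d k) (X k) := fun k => by
    rw [← toEuclidean_starProjection, S.starProjection_d_decomp hy h₀ hX]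
  have h2 : toEuclidean S.u (y + x₀ + ∑ k, X k) = toEuclidean S.u y := by
    rw [← toEuclidean_starProjection, S.starProjection_u_decomp hy h₀ hX]
  simp only [sphereMap, h1, h2]

theorem ellipsoidPoint_normalize {k : Fin S.g} {r : ℝ} (hr : 0 < r) {x : 𝔤}
    (hx : x ∈ S.d k) (hxr : inner ℝ (S.B x) x = r) :
    S.ellipsoidPoint k r (‖toEuclidean (S.d k) x‖⁻¹ • toEuclidean (S.d k) x) = x := by
  have hx0 : ‖x‖ ≠ 0 := by
    rw [norm_ne_zero_iff]; rintro rfl; simp at hxr; exact hr.ne hxr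
  have hn : 0 < ‖x‖ := lt_of_le_of_ne (norm_nonneg _) hx0.symm
  rw [ellipsoidPoint, map_smul, ofEuclidean_toEuclidean _ hx, norm_toEuclidean _ hx, map_smul,
    inner_smul_left, inner_smul_right, hxr, conj_trivial]
  -- By homogeneity of degree two the form takes the value `r / ‖x‖²` at the normalized vector, so
  -- the rescaling factor is `‖x‖`.
  have : r / (‖x‖⁻¹ * (‖x‖⁻¹ * r)) = ‖x‖ ^ 2 := by field_simp
  rw [this, Real.sqrt_sq hn.le, smul_smul, mul_inv_cancel₀ hx0, one_smul]

/-- A ray from the origin of `𝔡_k` meets its ellipsoid exactly once, and once the `X_k` are known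
the length of `y` is prescribed and positive. Hence the directions of the components are free and
determine the point. -/
theorem levelSet_diffeomorphic {c₀ : 𝔤} (hc₀ : c₀ ∈ S.d₀) {c b : Fin S.g → ℝ} {c' : ℝ}
    (hB : ∀ k, S.BPosDef k) (hcpos : ∀ k, 0 < c k)
    (hb : ∀ k, IsLeast (S.unitValues k) (b k)) (hc : ‖c₀‖ ^ 2 + ∑ k, c k / b k < c') :
    DiffeomorphicSets (S.levelSet c₀ c c')
      (sphereProduct (fun k => Module.finrank ℝ (S.d k)) (Module.finrank ℝ S.u)) := by
  have key : ∀ x ∈ S.levelSet c₀ c c', ∃ y ∈ S.u, ∃ X : Fin S.g → 𝔤, (∀ k, X k ∈ S.d k) ∧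
      x = y + c₀ + ∑ k, X k ∧ y ≠ 0 ∧ (∀ k, X k ≠ 0) ∧
      (∀ k, inner ℝ (S.B (X k)) (X k) = c k) ∧
        ‖y‖ ^ 2 = c' - ‖c₀‖ ^ 2 - ∑ k, ‖X k‖ ^ 2 := by
    intro x hx
    obtain ⟨y, hy, X, hX, rfl⟩ := S.exists_of_mem_levelSet hx
    rw [S.decomp_mem_levelSet hc₀ hy hX] at hx
    refine ⟨y, hy, X, hX, rfl, ?_, fun k h => ?_, hx⟩
    · rintro rfl
      have := S.radius_pos hB hb hc hX hx.1
      rw [← hx.2] at this; simp at this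
    · have := hx.1 k
      rw [h] at this; simp at this; exact (hcpos k).ne this
  have ne_of_norm : ∀ {n : ℕ} {ξ : EuclideanSpace ℝ (Fin n)}, ‖ξ‖ = 1 → ξ ≠ 0 := by
    rintro n ξ h rfl; simp at h
  have tne : ∀ {K : Submodule ℝ 𝔤} {x : 𝔤}, x ∈ K → x ≠ 0 → toEuclidean K x ≠ 0 := by
    intro K x hx h
    rw [← norm_ne_zero_iff, norm_toEuclidean K hx]; exact norm_ne_zero_iff.2 h
  have hsm : ∀ p ∈ sphereProduct (fun k => Module.finrank ℝ (S.d k)) (Module.finrank ℝ S.u),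
      0 < c' - ‖c₀‖ ^ 2 - ∑ k, ‖S.ellipsoidPoint k (c k) (p.1 k)‖ ^ 2 := fun p hp =>
    S.radius_pos hB hb hc (fun k => S.ellipsoidPoint_mem _ _ _)
      fun k => S.inner_B_ellipsoidPoint (hB k) (hcpos k) (ne_of_norm (hp.1 k))
  refine ⟨S.sphereMap, S.sphereMapInv c₀ c c', ?_, ?_, ⟨?_, ?_⟩, ?_, ?_⟩
  · intro x hx
    obtain ⟨y, hy, X, hX, rfl, hy0, hX0, -⟩ := key x hx
    rw [S.sphereMap_decomp hy hc₀ hX]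
    exact ⟨fun k => normalize_norm_eq_one (tne (hX k) (hX0 k)),
      normalize_norm_eq_one (tne hy hy0)⟩
  · intro p hp
    rw [sphereMapInv, S.decomp_mem_levelSet hc₀ (Submodule.smul_mem _ _ (ofEuclidean_mem _ _))
      (fun k => S.ellipsoidPoint_mem _ _ _)]
    refine ⟨fun k => S.inner_B_ellipsoidPoint (hB k) (hcpos k) (ne_of_norm (hp.1 k)), ?_⟩
    rw [norm_smul, norm_ofEuclidean, hp.2, mul_one, Real.norm_of_nonneg (Real.sqrt_nonneg _),
      Real.sq_sqrt (hsm p hp).le]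
  · intro x hx
    obtain ⟨y, hy, X, hX, rfl, hy0, hX0, hXc, hyn⟩ := key x hx
    rw [S.sphereMap_decomp hy hc₀ hX, sphereMapInv]
    simp only [S.ellipsoidPoint_normalize (hcpos _) (hX _) (hXc _)]
    rw [← hyn, Real.sqrt_sq (norm_nonneg _), map_smul, ofEuclidean_toEuclidean _ hy,
      norm_toEuclidean _ hy, smul_smul, mul_inv_cancel₀ (norm_ne_zero_iff.2 hy0), one_smul]
  · intro p hp
    rw [sphereMapInv, S.sphereMap_decomp (Submodule.smul_mem _ _ (ofEuclidean_mem _ _)) hc₀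
      (fun k => S.ellipsoidPoint_mem _ _ _)]
    refine Prod.ext (funext fun k => ?_) ?_
    · simp only [ellipsoidPoint, map_smul, toEuclidean_ofEuclidean]
      exact inv_norm_smul_smul (Real.sqrt_pos.2 (div_pos (hcpos k)
        (S.inner_B_ofEuclidean_pos (hB k) (ne_of_norm (hp.1 k))))) (hp.1 k)
    · simp only [map_smul, toEuclidean_ofEuclidean]
      exact inv_norm_smul_smul (Real.sqrt_pos.2 (hsm p hp)) hp.2
  · refine smoothOnSubset_of_eventually fun x hx => ?_
    obtain ⟨y, hy, X, hX, rfl, hy0, hX0, -⟩ := key x hx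
    have h1 : ∀ k, toEuclidean (S.d k) (y + c₀ + ∑ k, X k) ≠ 0 := fun k => by
      rw [← toEuclidean_starProjection, S.starProjection_d_decomp hy hc₀ hX]
      exact tne (hX k) (hX0 k)
    have h2 : toEuclidean S.u (y + c₀ + ∑ k, X k) ≠ 0 := by
      rw [← toEuclidean_starProjection, S.starProjection_u_decomp hy hc₀ hX]
      exact tne hy hy0
    -- Smoothness is needed on a neighbourhood in the ambient space, and the components remain
    -- nonzero at nearby points outside the level set.
    have e1 := Filter.eventually_all.2 fun k =>
      (toEuclidean (S.d k)).continuous.continuousAt.eventually_ne (h1 k)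
    have e2 := (toEuclidean S.u).continuous.continuousAt.eventually_ne h2
    filter_upwards [e1, e2] with z hz1 hz2
    have hn : ∀ {K : Submodule ℝ 𝔤}, toEuclidean K z ≠ 0 →
        ContDiffAt ℝ ∞ (fun x => ‖toEuclidean K x‖⁻¹ • toEuclidean K x) z := fun {K} h => by
      have h3 : ContDiffAt ℝ ∞ (fun x => toEuclidean K x) z :=
        (toEuclidean K).contDiff.contDiffAt
      exact ((h3.norm ℝ h).inv (norm_ne_zero_iff.2 h)).smul h3
    exact (contDiffAt_pi.2 fun k => hn (hz1 k)).prodMk (hn hz2)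
  · refine smoothOnSubset_of_eventually fun p hp => ?_
    have hE : ∀ q : (∀ k, EuclideanSpace ℝ (Fin (Module.finrank ℝ (S.d k)))) ×
        EuclideanSpace ℝ (Fin (Module.finrank ℝ S.u)), (∀ k, q.1 k ≠ 0) → ∀ k,
        ContDiffAt ℝ ∞ (fun q : (∀ k, EuclideanSpace ℝ (Fin (Module.finrank ℝ (S.d k)))) ×
          EuclideanSpace ℝ (Fin (Module.finrank ℝ S.u)) =>
            S.ellipsoidPoint k (c k) (q.1 k)) q := fun q hq k =>
      (S.contDiffAt_ellipsoidPoint (hB k) (hcpos k) (hq k)).comp q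
        ((contDiffAt_pi.1 contDiffAt_fst) k)
    have hR : ∀ q : (∀ k, EuclideanSpace ℝ (Fin (Module.finrank ℝ (S.d k)))) ×
        EuclideanSpace ℝ (Fin (Module.finrank ℝ S.u)), (∀ k, q.1 k ≠ 0) →
        ContDiffAt ℝ ∞ (fun q : (∀ k, EuclideanSpace ℝ (Fin (Module.finrank ℝ (S.d k)))) ×
          EuclideanSpace ℝ (Fin (Module.finrank ℝ S.u)) =>
          c' - ‖c₀‖ ^ 2 - ∑ k, ‖S.ellipsoidPoint k (c k) (q.1 k)‖ ^ 2) q := fun q hq =>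
      contDiffAt_const.sub (ContDiffAt.sum fun k _ => (hE q hq k).norm_sq ℝ)
    have e1 : ∀ᶠ q : (∀ k, EuclideanSpace ℝ (Fin (Module.finrank ℝ (S.d k)))) ×
        EuclideanSpace ℝ (Fin (Module.finrank ℝ S.u)) in nhds p, ∀ k, q.1 k ≠ 0 :=
      Filter.eventually_all.2 fun k =>
        (((continuous_apply k).comp continuous_fst).continuousAt (x := p)).eventually_ne
          (ne_of_norm (hp.1 k))
    have e2 := (hR p fun k => ne_of_norm (hp.1 k)).continuousAt.eventually_ne (hsm p hp).ne'
    filter_upwards [e1, e2] with q hq1 hq2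
    have h3 : ContDiffAt ℝ ∞ (fun q : (∀ k, EuclideanSpace ℝ (Fin (Module.finrank ℝ (S.d k)))) ×
        EuclideanSpace ℝ (Fin (Module.finrank ℝ S.u)) => ofEuclidean S.u q.2) q :=
      (ofEuclidean S.u).contDiff.contDiffAt.comp q contDiffAt_snd
    exact (((((hR q hq1).sqrt hq2).smul h3)).add contDiffAt_const).add
      (ContDiffAt.sum fun k _ => hE q hq1 k)

end Euclidean

end EPSData

/-! ### Conjugate semi-axes and the rotation `X ↦ [e, B X]`. -/

theorem exists_eq_smul_add_smul {E : Type*} [AddCommGroup E] [Module ℝ E] {K : Submodule ℝ E}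
    (hK : Module.finrank ℝ K = 2) {p q : E} (hp : p ∈ K) (hq : q ∈ K)
    (h : ∀ a b : ℝ, a • p + b • q = 0 → a = 0 ∧ b = 0) {x : E} (hx : x ∈ K) :
    ∃ a b : ℝ, x = a • p + b • q := by
  have hli : LinearIndependent ℝ ![(⟨p, hp⟩ : K), ⟨q, hq⟩] := by
    rw [LinearIndependent.pair_iff]
    exact fun a b hab => h a b (congrArg Subtype.val hab)
  have : Module.Finite ℝ K := Module.finite_of_finrank_eq_succ hK
  have hs := hli.span_eq_top_of_card_eq_finrank' (by simp [hK])
  have hx' : (⟨x, hx⟩ : K) ∈ Submodule.span ℝ (Set.range ![(⟨p, hp⟩ : K), ⟨q, hq⟩]) := by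
    rw [hs]; trivial
  rw [Matrix.range_cons, Matrix.range_cons, Matrix.range_empty, Set.union_empty,
    Set.singleton_union, Submodule.mem_span_pair] at hx'
  obtain ⟨a, b, hab⟩ := hx'
  exact ⟨a, b, (congrArg Subtype.val hab).symm⟩

namespace EPSData

variable {𝔤 : Type*} [NormedLieRing 𝔤] [InvariantInnerLieAlgebra 𝔤] (S : EPSData 𝔤)

/-- Conjugate semi-axes `p, q` of the ellipse `⟨B_k x, x⟩ = r` in `𝔡_k`, in terms of which
`x ↦ [e, B_k x]` is a rotation with angular velocity `ν`; in dimension one `q` and `ν` vanish. -/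
structure EllipseFrame (e : 𝔤) (k : Fin S.g) (r : ℝ) (p q : 𝔤) (ν : ℝ) : Prop where
  p_mem : p ∈ S.d k
  q_mem : q ∈ S.d k
  B_p_p : inner ℝ (S.B p) p = r
  B_p_q : inner ℝ (S.B p) q = 0
  span : ∀ x ∈ S.d k, ∃ a b : ℝ, x = a • p + b • q
  lie_p : ∀ w ∈ S.d k, inner ℝ ⁅e, S.B p⁆ w = ν * inner ℝ q w
  lie_q : ∀ w ∈ S.d k, inner ℝ ⁅e, S.B q⁆ w = -(ν * inner ℝ p w)
  two : Module.finrank ℝ (S.d k) = 2 → inner ℝ (S.B q) q = r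
  one : Module.finrank ℝ (S.d k) = 1 → q = 0 ∧ ν = 0

theorem inner_lie_swap (e x y : 𝔤) : inner ℝ ⁅e, x⁆ y = -inner ℝ ⁅e, y⁆ x := by
  rw [← lie_skew, inner_neg_left, InvariantInnerLieAlgebra.inner_lie, real_inner_comm]

theorem inner_lie_right' (x y : 𝔤) : inner ℝ ⁅x, y⁆ y = 0 := by
  rw [real_inner_comm, inner_lie_right]

theorem exists_inner_B_eq {k : Fin S.g} (hB : S.BPosDef k) {r : ℝ} (hr : 0 < r) {x : 𝔤}
    (hx : x ∈ S.d k) (h0 : x ≠ 0) :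
    ∃ a : ℝ, inner ℝ (S.B (a • x)) (a • x) = r := by
  have hp := hB x hx h0
  refine ⟨Real.sqrt (r / inner ℝ (S.B x) x), ?_⟩
  rw [map_smul, inner_smul_left, inner_smul_right, conj_trivial, ← mul_assoc,
    Real.mul_self_sqrt (div_pos hr hp).le, div_mul_cancel₀ _ hp.ne']

/-- On a line `B p` is a multiple of `p`, and `[e, p]` is orthogonal to `p`, so there is no motion:
`q = 0` and `ν = 0`. -/
theorem exists_ellipseFrame_one (e : 𝔤) {k : Fin S.g} (hB : S.BPosDef k) {r : ℝ} (hr : 0 < r)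
    (hk : Module.finrank ℝ (S.d k) = 1) : ∃ p q ν, S.EllipseFrame e k r p q ν := by
  obtain ⟨v, hv, hspan⟩ := finrank_eq_one_iff'.1 hk
  obtain ⟨a, ha⟩ := S.exists_inner_B_eq hB hr v.2 (by simpa using hv)
  have hs : ∀ x ∈ S.d k, ∃ b : ℝ, x = b • (v : 𝔤) := fun x hx => by
    obtain ⟨b, hb⟩ := hspan ⟨x, hx⟩
    exact ⟨b, (congrArg Subtype.val hb).symm⟩
  have ha0 : a ≠ 0 := by rintro rfl; simp at ha; exact hr.ne ha
  refine ⟨a • v, 0, 0, Submodule.smul_mem _ _ v.2, zero_mem _, ha, inner_zero_right _, ?_, ?_,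
    by simp, by omega, by simp⟩
  · intro x hx
    obtain ⟨b, rfl⟩ := hs x hx
    exact ⟨b / a, 0, by rw [smul_smul, div_mul_cancel₀ _ ha0]; simp⟩
  · intro w hw
    obtain ⟨b, rfl⟩ := hs w hw
    obtain ⟨b', hb'⟩ := hs _ (S.B_d v.2)
    rw [map_smul, hb']
    simp only [lie_smul, inner_smul_left, inner_smul_right, inner_lie_right']
    simp

/-- The form of `B` is diagonalized by Gram–Schmidt, both vectors being scaled to the value `r`. Up
to the factor `r`, `B p` and `B q` are then the basis dual to `p, q`; as `ad e` is skew, only `⟨[e,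
B p], B q⟩` survives, and it determines `ν`. -/
theorem exists_ellipseFrame_two (e : 𝔤) {k : Fin S.g} (hB : S.BPosDef k) {r : ℝ} (hr : 0 < r)
    (hk : Module.finrank ℝ (S.d k) = 2) : ∃ p q ν, S.EllipseFrame e k r p q ν := by
  have : Module.Finite ℝ (S.d k) := Module.finite_of_finrank_eq_succ hk
  let b := Module.finBasisOfFinrankEq ℝ (S.d k) hk
  have hb : ∀ s t : ℝ, s • (b 0 : 𝔤) + t • (b 1 : 𝔤) = 0 → s = 0 ∧ t = 0 := by
    intro s t h
    have hli : LinearIndependent ℝ ![b 0, b 1] := by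
      convert b.linearIndependent using 1
      ext i; fin_cases i <;> rfl
    exact LinearIndependent.pair_iff.1 hli s t (Subtype.ext h)
  have h0 : (b 0 : 𝔤) ≠ 0 := fun h => by simpa using (hb 1 0 (by simp [h])).1
  obtain ⟨a, ha⟩ := S.exists_inner_B_eq hB hr (b 0).2 h0
  set p := a • (b 0 : 𝔤) with hp
  have hpm : p ∈ S.d k := Submodule.smul_mem _ _ (b 0).2
  set q₀ := (b 1 : 𝔤) - (inner ℝ (S.B p) (b 1 : 𝔤) / r) • p with hq₀
  have hq₀m : q₀ ∈ S.d k := sub_mem (b 1).2 (Submodule.smul_mem _ _ hpm)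
  have hq₀0 : q₀ ≠ 0 := by
    intro h
    have := (hb (-(inner ℝ (S.B p) (b 1 : 𝔤) / r * a)) 1 (by
      rw [← h, hq₀, hp, smul_smul]; module)).2
    exact one_ne_zero this
  have hpq₀ : inner ℝ (S.B p) q₀ = 0 := by
    rw [hq₀, inner_sub_right, inner_smul_right, ha, div_mul_cancel₀ _ hr.ne', sub_self]
  obtain ⟨a', ha'⟩ := S.exists_inner_B_eq hB hr hq₀m hq₀0
  set q := a' • q₀ with hq
  have hqm : q ∈ S.d k := Submodule.smul_mem _ _ hq₀m
  have hpq : inner ℝ (S.B p) q = 0 := by rw [hq, inner_smul_right, hpq₀, mul_zero]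
  have hqp : inner ℝ (S.B q) p = 0 := by rw [B_inner, real_inner_comm, hpq]
  have hspan : ∀ x ∈ S.d k, ∃ s t : ℝ, x = s • p + t • q := fun x hx =>
    exists_eq_smul_add_smul hk hpm hqm (fun s t h => by
      have h1 := congrArg (fun z => inner ℝ (S.B p) z) h
      have h2 := congrArg (fun z => inner ℝ (S.B q) z) h
      simp only [inner_add_right, inner_smul_right, ha, ha', hpq, hqp, inner_zero_right, mul_zero,
        add_zero, zero_add, mul_eq_zero, hr.ne', or_false] at h1 h2
      exact ⟨h1, h2⟩) hx
  -- Test vectors are expanded in `B p, B q` rather than `p, q`, since the skew pairing is known on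
  -- these.
  have hspan' : ∀ x ∈ S.d k, ∃ s t : ℝ, x = s • S.B p + t • S.B q := fun x hx =>
    exists_eq_smul_add_smul hk (S.B_d hpm) (S.B_d hqm) (fun s t h => by
      have h1 := congrArg (fun z => inner ℝ z p) h
      have h2 := congrArg (fun z => inner ℝ z q) h
      simp only [inner_add_left, inner_smul_left, ha, ha', hpq, hqp, inner_zero_left, mul_zero,
        add_zero, zero_add, mul_eq_zero, hr.ne', or_false, conj_trivial] at h1 h2
      exact ⟨h1, h2⟩) hx
  refine ⟨p, q, inner ℝ ⁅e, S.B p⁆ (S.B q) / r, hpm, hqm, ha, hpq, hspan, ?_, ?_, fun _ => ha',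
    by omega⟩
  · intro w hw
    obtain ⟨s, t, rfl⟩ := hspan' w hw
    have h1 : inner ℝ q (S.B p) = 0 := by rw [real_inner_comm, hpq]
    have h2 : inner ℝ q (S.B q) = r := by rw [real_inner_comm, ha']
    rw [inner_add_right, inner_smul_right, inner_smul_right, inner_lie_right', inner_add_right,
      inner_smul_right, inner_smul_right, h1, h2]
    field_simp
    ring
  · intro w hw
    obtain ⟨s, t, rfl⟩ := hspan' w hw
    rw [inner_add_right, inner_smul_right, inner_smul_right, inner_lie_right',
      inner_lie_swap e (S.B q)]
    simp only [inner_add_right, inner_smul_right, real_inner_comm (S.B _), hqp, ha]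
    field_simp
    ring

/-! ### Phases and the parametrization of the level set. -/

/-- The phases of the components: the angles of the torus on the planes, signs on the lines. -/
noncomputable def phase {r : ℕ} (idx : {k // Module.finrank ℝ (S.d k) = 2} ≃ Fin r)
    (ε : Fin S.g → ℝ) (z : Fin r → ℂ) (k : Fin S.g) : ℂ :=
  if h : Module.finrank ℝ (S.d k) = 2 then z (idx ⟨k, h⟩) else ε k

/-- The point with phase `w` on the ellipse with conjugate semi-axes `p, σ q`. -/
noncomputable def ellipsePoint (p q : 𝔤) (σ : ℝ) (w : ℂ) : 𝔤 := w.re • p + (σ * w.im) • q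

theorem ellipsePoint_mem {K : Submodule ℝ 𝔤} {p q : 𝔤} (hp : p ∈ K) (hq : q ∈ K) (σ : ℝ) (w : ℂ) :
    ellipsePoint p q σ w ∈ K :=
  add_mem (Submodule.smul_mem _ _ hp) (Submodule.smul_mem _ _ hq)

theorem contDiff_ellipsePoint (p q : 𝔤) (σ : ℝ) : ContDiff ℝ ∞ (ellipsePoint p q σ) :=
  (Complex.reCLM.contDiff.smul contDiff_const).add
    ((contDiff_const.mul Complex.imCLM.contDiff).smul contDiff_const)

variable {S} in
theorem EllipseFrame.inner_B {e : 𝔤} {k : Fin S.g} {r : ℝ} {p q : 𝔤} {ν : ℝ}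
    (h : S.EllipseFrame e k r p q ν) (a b : ℝ) :
    inner ℝ (S.B (a • p + b • q)) (a • p + b • q) = a ^ 2 * r + b ^ 2 * inner ℝ (S.B q) q := by
  have hqp : inner ℝ (S.B q) p = 0 := by rw [B_inner, real_inner_comm, h.B_p_q]
  simp only [map_add, map_smul, inner_add_left, inner_add_right, inner_smul_left, inner_smul_right,
    conj_trivial, h.B_p_p, h.B_p_q, hqp]
  ring

/-- The square of the norm of the component in `𝔲` of a point of the level set. -/
noncomputable def radiusSq (c₀ : 𝔤) (c' : ℝ) (p q : Fin S.g → 𝔤) (σ : ℝ) (w : Fin S.g → ℂ) : ℝ :=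
  c' - ‖c₀‖ ^ 2 - ∑ k, ‖ellipsePoint (p k) (q k) σ (w k)‖ ^ 2

theorem contDiff_radiusSq (c₀ : 𝔤) (c' : ℝ) (p q : Fin S.g → 𝔤) (σ : ℝ) :
    ContDiff ℝ ∞ (S.radiusSq c₀ c' p q σ) :=
  contDiff_const.sub (ContDiff.sum fun k _ =>
    ((contDiff_ellipsePoint _ _ _).comp (contDiff_apply ℝ ℂ k)).norm_sq ℝ)

/-- The point of the level set with given phases. -/
noncomputable def phaseMap (e c₀ : 𝔤) (c' : ℝ) (p q : Fin S.g → 𝔤) (σ : ℝ) (w : Fin S.g → ℂ) :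
    𝔤 :=
  (σ * Real.sqrt (S.radiusSq c₀ c' p q σ w)) • e + c₀ + ∑ k, ellipsePoint (p k) (q k) σ (w k)

theorem contDiffAt_phaseMap (e c₀ : 𝔤) (c' : ℝ) (p q : Fin S.g → 𝔤) (σ : ℝ) {w : Fin S.g → ℂ}
    (h : 0 < S.radiusSq c₀ c' p q σ w) : ContDiffAt ℝ ∞ (S.phaseMap e c₀ c' p q σ) w :=
  (((contDiffAt_const.mul ((S.contDiff_radiusSq c₀ c' p q σ).contDiffAt.sqrt h.ne')).smul
    contDiffAt_const).add contDiffAt_const).add (ContDiffAt.sum fun k _ =>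
      ((contDiff_ellipsePoint _ _ _).comp (contDiff_apply ℝ ℂ k)).contDiffAt)

theorem contDiff_phase {r : ℕ} (idx : {k // Module.finrank ℝ (S.d k) = 2} ≃ Fin r)
    (ε : Fin S.g → ℝ) : ContDiff ℝ ∞ (S.phase idx ε) := by
  refine contDiff_pi.2 fun k => ?_
  unfold phase
  split_ifs with h
  · exact contDiff_apply ℝ ℂ _
  · exact contDiff_const

theorem norm_phase {r : ℕ} (idx : {k // Module.finrank ℝ (S.d k) = 2} ≃ Fin r)
    {ε : Fin S.g → ℝ} (hε : ∀ k, ε k ^ 2 = 1) {z : Fin r → ℂ} (hz : z ∈ stdTorus r) (k : Fin S.g) :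
    (S.phase idx ε z k).re ^ 2 + (S.phase idx ε z k).im ^ 2 = 1 := by
  unfold phase
  split_ifs with h
  · have := Complex.sq_norm (z (idx ⟨k, h⟩))
    rw [hz, Complex.normSq_apply] at this
    linarith
  · simp [hε k]

/-- The rates of change of the phases. -/
noncomputable def phaseRate {r : ℕ} (idx : {k // Module.finrank ℝ (S.d k) = 2} ≃ Fin r)
    (ψ : Fin r → ℝ) (k : Fin S.g) : ℝ :=
  if h : Module.finrank ℝ (S.d k) = 2 then ψ (idx ⟨k, h⟩) else 0

theorem hasDerivAt_phase {r : ℕ} (idx : {k // Module.finrank ℝ (S.d k) = 2} ≃ Fin r)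
    (ε : Fin S.g → ℝ) {φ : ℝ → Fin r → ℝ} {ψ : Fin r → ℝ} {t : ℝ} (hφ : HasDerivAt φ ψ t)
    (k : Fin S.g) :
    HasDerivAt (fun t => S.phase idx ε (torusPoint (φ t)) k)
      (S.phaseRate idx ψ k * Complex.I * S.phase idx ε (torusPoint (φ t)) k) t := by
  unfold phase phaseRate
  split_ifs with h
  · have h1 := ((hasDerivAt_pi.1 hφ (idx ⟨k, h⟩)).ofReal_comp.mul_const Complex.I).cexp
    refine h1.congr_deriv ?_
    rw [torusPoint, mul_comm]
  · simpa using hasDerivAt_const t (ε k : ℂ)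

theorem hasDerivAt_ellipsePoint (p q : 𝔤) (σ : ℝ) {w : ℝ → ℂ} {θ t : ℝ}
    (h : HasDerivAt w (θ * Complex.I * w t) t) :
    HasDerivAt (fun t => ellipsePoint p q σ (w t))
      (θ • (-(w t).im • p + (σ * (w t).re) • q)) t := by
  have h1 := Complex.reCLM.hasFDerivAt.comp_hasDerivAt t h
  have h2 := Complex.imCLM.hasFDerivAt.comp_hasDerivAt t h
  have h3 := (h1.smul_const p).add ((h2.const_mul σ).smul_const q)
  refine h3.congr_deriv ?_
  simp
  module

theorem torusPoint_mem {r : ℕ} (φ : Fin r → ℝ) : torusPoint φ ∈ stdTorus r := fun i => by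
  rw [torusPoint, Complex.norm_exp_ofReal_mul_I]

theorem contDiff_torusPoint {r : ℕ} : ContDiff ℝ ∞ (torusPoint (r := r)) := by
  refine contDiff_pi.2 fun i => ?_
  exact ((Complex.ofRealCLM.contDiff.comp (contDiff_apply ℝ ℝ i)).mul contDiff_const).cexp

theorem torusPoint_add_single {r : ℕ} (φ : Fin r → ℝ) (i : Fin r) :
    torusPoint (φ + Pi.single i (2 * Real.pi)) = torusPoint φ := by
  funext j
  rcases eq_or_ne j i with rfl | h
  · simp only [torusPoint, Pi.add_apply, Pi.single_eq_same, Complex.ofReal_add, Complex.ofReal_mul,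
      Complex.ofReal_ofNat, add_mul, Complex.exp_add, Complex.exp_two_pi_mul_I, mul_one]
  · simp [torusPoint, Pi.single_eq_of_ne h]

theorem inner_d_decomp {y x₀ w : 𝔤} {X : Fin S.g → 𝔤} (hy : y ∈ S.u) (h₀ : x₀ ∈ S.d₀)
    (hX : ∀ k, X k ∈ S.d k) {k : Fin S.g} (hw : w ∈ S.d k) :
    inner ℝ w (y + x₀ + ∑ k, X k) = inner ℝ w (X k) := by
  rw [inner_add_right, inner_add_right, real_inner_comm, S.inner_u_d hy hw, real_inner_comm,
    S.inner_d₀_d h₀ hw, add_zero, zero_add, inner_sum]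
  exact Finset.sum_eq_single k (fun j _ hj => S.inner_d_d hj.symm hw (hX j)) (by simp)

/-! ### The tori and the equations in angular coordinates. -/

section Torus

variable {e c₀ : 𝔤} {c : Fin S.g → ℝ} {c' : ℝ} {p q : Fin S.g → 𝔤}
  {ν : Fin S.g → ℝ} {σ : ℝ} {ε : Fin S.g → ℝ} {r : ℕ}
  {idx : {k // Module.finrank ℝ (S.d k) = 2} ≃ Fin r}

variable {S} in
theorem EllipseFrame.inner_B_ellipsePoint {k : Fin S.g} {e p q : 𝔤} {r ν : ℝ}
    (h : S.EllipseFrame e k r p q ν) (hdim : Module.finrank ℝ (S.d k) = 1 ∨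
      Module.finrank ℝ (S.d k) = 2) (hσ : σ ^ 2 = 1) {w : ℂ} (hw : w.re ^ 2 + w.im ^ 2 = 1)
    (hw1 : Module.finrank ℝ (S.d k) = 1 → w.im = 0) :
    inner ℝ (S.B (ellipsePoint p q σ w)) (ellipsePoint p q σ w) = r := by
  rw [ellipsePoint, h.inner_B, mul_pow, hσ]
  rcases hdim with h1 | h2
  · rw [hw1 h1] at hw ⊢
    rw [(h.one h1).1]
    linear_combination r * hw
  · rw [h.two h2]
    linear_combination r * hw

theorem phase_im_of_one (h : Module.finrank ℝ (S.d k) = 1) (z : Fin r → ℂ) :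
    (S.phase idx ε z k).im = 0 := by
  rw [phase, dif_neg (by omega), Complex.ofReal_im]

theorem inner_B_phase (hf : ∀ k, S.EllipseFrame e k (c k) (p k) (q k) (ν k))
    (hdim : ∀ k, Module.finrank ℝ (S.d k) = 1 ∨ Module.finrank ℝ (S.d k) = 2)
    (hσ : σ ^ 2 = 1) (hε : ∀ k, ε k ^ 2 = 1) {z : Fin r → ℂ} (hz : z ∈ stdTorus r) (k : Fin S.g) :
    inner ℝ (S.B (ellipsePoint (p k) (q k) σ (S.phase idx ε z k)))
      (ellipsePoint (p k) (q k) σ (S.phase idx ε z k)) = c k :=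
  (hf k).inner_B_ellipsePoint (hdim k) hσ (S.norm_phase idx hε hz k)
    fun h => S.phase_im_of_one h z

/-- The angular coordinates, as a point of the standard torus. -/
noncomputable def angleMap (idx : {k // Module.finrank ℝ (S.d k) = 2} ≃ Fin r) (c : Fin S.g → ℝ)
    (p q : Fin S.g → 𝔤) (σ : ℝ) (x : 𝔤) : Fin r → ℂ := fun i =>
  ((inner ℝ (S.B (p (idx.symm i))) x / c (idx.symm i) : ℝ) : ℂ) +
    ((σ * inner ℝ (S.B (q (idx.symm i))) x / c (idx.symm i) : ℝ) : ℂ) * Complex.I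

theorem contDiff_angleMap : ContDiff ℝ ∞ (S.angleMap idx c p q σ) := by
  refine contDiff_pi.2 fun i => ?_
  refine ContDiff.add (Complex.ofRealCLM.contDiff.comp ?_)
    ((Complex.ofRealCLM.contDiff.comp ?_).mul contDiff_const)
  · exact (contDiff_const.inner ℝ contDiff_id).div_const _
  · exact (contDiff_const.mul (contDiff_const.inner ℝ contDiff_id)).div_const _

/-- Pairing with `B p_k` and `B q_k` isolates the coefficients of `p_k` and `q_k`, by conjugacy. The
second coefficient carries a factor `σ`, undone by `σ² = 1`. No condition on the moduli of `z` is
needed. -/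
theorem angleMap_phaseMap (hc₀ : c₀ ∈ S.d₀) (he : e ∈ S.u) (hcpos : ∀ k, 0 < c k)
    (hf : ∀ k, S.EllipseFrame e k (c k) (p k) (q k) (ν k)) (hσ : σ ^ 2 = 1) (z : Fin r → ℂ) :
    S.angleMap idx c p q σ (S.phaseMap e c₀ c' p q σ (S.phase idx ε z)) = z := by
  funext i
  obtain ⟨⟨k, hk⟩, rfl⟩ := idx.surjective i
  have hph : S.phase idx ε z k = z (idx ⟨k, hk⟩) := by rw [phase, dif_pos hk]
  have hqp : inner ℝ (S.B (q k)) (p k) = 0 := by rw [B_inner, real_inner_comm, (hf k).B_p_q]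
  rw [angleMap, phaseMap]
  simp only [Equiv.symm_apply_apply]
  rw [S.inner_d_decomp (Submodule.smul_mem _ _ he) hc₀
      (fun k => ellipsePoint_mem (hf k).p_mem (hf k).q_mem _ _) (S.B_d (hf k).p_mem),
    S.inner_d_decomp (Submodule.smul_mem _ _ he) hc₀
      (fun k => ellipsePoint_mem (hf k).p_mem (hf k).q_mem _ _) (S.B_d (hf k).q_mem), hph,
    ellipsePoint, inner_add_right, inner_add_right, inner_smul_right, inner_smul_right,
    inner_smul_right, inner_smul_right, (hf k).B_p_p, (hf k).B_p_q, (hf k).two hk, hqp]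
  have h1 : ((z (idx ⟨k, hk⟩)).re * c k + σ * (z (idx ⟨k, hk⟩)).im * 0) / c k =
      (z (idx ⟨k, hk⟩)).re := by have := (hcpos k).ne'; field_simp; ring
  have h2 : σ * ((z (idx ⟨k, hk⟩)).re * 0 + σ * (z (idx ⟨k, hk⟩)).im * c k) / c k =
      (z (idx ⟨k, hk⟩)).im := by
    have := (hcpos k).ne'
    rw [div_eq_iff this]
    linear_combination (z (idx ⟨k, hk⟩)).im * c k * hσ
  rw [h1, h2, Complex.re_add_im]

variable [FiniteDimensional ℝ 𝔤]

theorem phaseMap_mem_levelSet (hc₀ : c₀ ∈ S.d₀) (he : e ∈ S.u) (he1 : ‖e‖ = 1)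
    (hf : ∀ k, S.EllipseFrame e k (c k) (p k) (q k) (ν k)) (hσ : σ ^ 2 = 1) {w : Fin S.g → ℂ}
    (hw : ∀ k, inner ℝ (S.B (ellipsePoint (p k) (q k) σ (w k)))
      (ellipsePoint (p k) (q k) σ (w k)) = c k) (hR : 0 < S.radiusSq c₀ c' p q σ w) :
    S.phaseMap e c₀ c' p q σ w ∈ S.levelSet c₀ c c' := by
  rw [phaseMap, S.decomp_mem_levelSet hc₀ (Submodule.smul_mem _ _ he)
    (fun k => ellipsePoint_mem (hf k).p_mem (hf k).q_mem _ _)]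
  refine ⟨hw, ?_⟩
  rw [norm_smul, he1, mul_one, Real.norm_eq_abs, sq_abs, mul_pow, hσ, one_mul,
    Real.sq_sqrt hR.le, radiusSq]

/-- Every point of the level set has phases. -/
theorem exists_phaseMap_eq (hc₀ : c₀ ∈ S.d₀) (he1 : ‖e‖ = 1)
    (hu : ∀ z ∈ S.u, ∃ a : ℝ, z = a • e) (hcpos : ∀ k, 0 < c k)
    (hf : ∀ k, S.EllipseFrame e k (c k) (p k) (q k) (ν k))
    (hdim : ∀ k, Module.finrank ℝ (S.d k) = 1 ∨ Module.finrank ℝ (S.d k) = 2)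
    (idx : {k // Module.finrank ℝ (S.d k) = 2} ≃ Fin r) {x : 𝔤} (hx : x ∈ S.levelSet c₀ c c') :
    ∃ (σ : ℝ) (ε : Fin S.g → ℝ) (z : Fin r → ℂ), (σ = 1 ∨ σ = -1) ∧ (∀ k, ε k = 1 ∨ ε k = -1) ∧
      (∀ k, Module.finrank ℝ (S.d k) ≠ 1 → ε k = 1) ∧ z ∈ stdTorus r ∧
      x = S.phaseMap e c₀ c' p q σ (S.phase idx ε z) := by
  obtain ⟨y, hy, X, hX, rfl⟩ := S.exists_of_mem_levelSet hx
  rw [S.decomp_mem_levelSet hc₀ hy hX] at hx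
  obtain ⟨a, rfl⟩ := hu y hy
  choose s t hst using fun k => (hf k).span (X k) (hX k)
  have hσ : ∃ σ : ℝ, (σ = 1 ∨ σ = -1) ∧ a = σ * |a| := by
    rcases le_total 0 a with h | h
    · exact ⟨1, Or.inl rfl, by rw [abs_of_nonneg h, one_mul]⟩
    · exact ⟨-1, Or.inr rfl, by rw [abs_of_nonpos h]; ring⟩
  obtain ⟨σ, hσ, ha⟩ := hσ
  have hσ2 : σ ^ 2 = 1 := by rcases hσ with rfl | rfl <;> norm_num
  have hc1 : ∀ k, Module.finrank ℝ (S.d k) = 1 → s k = 1 ∨ s k = -1 := fun k hk => by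
    have h := hx.1 k
    rw [hst k, (hf k).inner_B, ((hf k).one hk).1, map_zero, inner_zero_left, mul_zero,
      add_zero] at h
    exact mul_self_eq_one_iff.1 (mul_right_cancel₀ (hcpos k).ne' (by rw [← pow_two, h, one_mul]))
  have hc2 : ∀ k, Module.finrank ℝ (S.d k) = 2 → s k ^ 2 + t k ^ 2 = 1 := fun k hk => by
    have h := hx.1 k
    rw [hst k, (hf k).inner_B, (hf k).two hk, ← add_mul] at h
    exact mul_right_cancel₀ (hcpos k).ne' (by rw [h, one_mul])
  let ε : Fin S.g → ℝ := fun k => if Module.finrank ℝ (S.d k) = 1 then s k else 1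
  -- The factor `σ` compensates the one on the semi-axis `q` in `ellipsePoint`.
  let z : Fin r → ℂ := fun i => ⟨s (idx.symm i), σ * t (idx.symm i)⟩
  have hXe : ∀ k, ellipsePoint (p k) (q k) σ (S.phase idx ε z k) = X k := by
    intro k
    rw [ellipsePoint, hst k]
    rcases hdim k with h | h
    · rw [phase, dif_neg (by omega), ((hf k).one h).1]
      simp [ε, h]
    · have e1 : S.phase idx ε z k = ⟨s k, σ * t k⟩ := by
        rw [phase, dif_pos h]; simp [z]
      rw [e1]
      simp only
      rw [← mul_assoc, ← pow_two, hσ2, one_mul]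
  refine ⟨σ, ε, z, hσ, fun k => ?_, fun k hk => if_neg hk, fun i => ?_, ?_⟩
  · by_cases h : Module.finrank ℝ (S.d k) = 1
    · simp only [ε, if_pos h]; exact hc1 k h
    · left; exact if_neg h
  · have h := hc2 _ (idx.symm i).2
    rw [← sq_eq_sq₀ (norm_nonneg _) zero_le_one, Complex.sq_norm, Complex.normSq_apply]
    simp only [z]
    linear_combination h + t (idx.symm i) ^ 2 * hσ2
  · rw [phaseMap, radiusSq]
    simp only [hXe]
    rw [← hx.2, Real.sqrt_sq (norm_nonneg _), norm_smul, he1, mul_one, Real.norm_eq_abs, ← ha]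

/-- The signs are determined by the point. -/
theorem phaseMap_injective (hc₀ : c₀ ∈ S.d₀) (he : e ∈ S.u) (he1 : ‖e‖ = 1)
    (hcpos : ∀ k, 0 < c k) (hf : ∀ k, S.EllipseFrame e k (c k) (p k) (q k) (ν k))
    {σ' : ℝ} {ε' : Fin S.g → ℝ} (hσ : σ = 1 ∨ σ = -1) (hσ' : σ' = 1 ∨ σ' = -1) {z z' : Fin r → ℂ}
    (hR : 0 < S.radiusSq c₀ c' p q σ (S.phase idx ε z))
    (hR' : 0 < S.radiusSq c₀ c' p q σ' (S.phase idx ε' z'))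
    (h : S.phaseMap e c₀ c' p q σ (S.phase idx ε z) =
      S.phaseMap e c₀ c' p q σ' (S.phase idx ε' z')) :
    σ = σ' ∧ ∀ k, Module.finrank ℝ (S.d k) = 1 → ε k = ε' k := by
  have hX : ∀ (σ : ℝ) (w : Fin S.g → ℂ) k, ellipsePoint (p k) (q k) σ (w k) ∈ S.d k :=
    fun σ w k => ellipsePoint_mem (hf k).p_mem (hf k).q_mem _ _
  have hu : ∀ a : ℝ, a • e ∈ S.u := fun a => Submodule.smul_mem _ _ he
  constructor
  -- The component along `e` is `σ` times a positive root, so its sign is `σ`.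
  · have h1 := congrArg (fun x => inner ℝ e (S.u.starProjection x)) h
    simp only [phaseMap, S.starProjection_u_decomp (hu _) hc₀ (hX _ _), inner_smul_right,
      real_inner_self_eq_norm_sq, he1] at h1
    have a1 := Real.sqrt_pos.2 hR
    have a2 := Real.sqrt_pos.2 hR'
    rcases hσ with rfl | rfl <;> rcases hσ' with rfl | rfl <;> first | rfl | (exfalso; linarith)
  · intro k hk
    have h1 := congrArg (fun x => inner ℝ (S.B (p k)) x) h
    have hp : ∀ (ε : Fin S.g → ℝ) (z : Fin r → ℂ), S.phase idx ε z k = ε k := fun ε z => by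
      rw [phase, dif_neg (by omega)]
    simp only [phaseMap] at h1
    rw [S.inner_d_decomp (hu _) hc₀ (hX _ _) (S.B_d (hf k).p_mem),
      S.inner_d_decomp (hu _) hc₀ (hX _ _) (S.B_d (hf k).p_mem), hp, hp, ellipsePoint,
      ellipsePoint, ((hf k).one hk).1, smul_zero, smul_zero, add_zero, add_zero, inner_smul_right,
      inner_smul_right, (hf k).B_p_p] at h1
    exact mul_right_cancel₀ (hcpos k).ne' h1

/-- The Euler–Poincaré–Suslov equations in angular coordinates. -/
theorem isSolutionOn_phaseMap_iff (hc₀ : c₀ ∈ S.d₀) (he : e ∈ S.u) (he1 : ‖e‖ = 1)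
    (hu : ∀ z ∈ S.u, ∃ a : ℝ, z = a • e) (hcpos : ∀ k, 0 < c k)
    (hf : ∀ k, S.EllipseFrame e k (c k) (p k) (q k) (ν k))
    (hdim : ∀ k, Module.finrank ℝ (S.d k) = 1 ∨ Module.finrank ℝ (S.d k) = 2)
    (hσ : σ ^ 2 = 1) (hε : ∀ k, ε k ^ 2 = 1)
    (hR : ∀ z ∈ stdTorus r, 0 < S.radiusSq c₀ c' p q σ (S.phase idx ε z))
    {I : Set ℝ} {φ : ℝ → Fin r → ℝ} (hI : IsOpen I) (hφ : DifferentiableOn ℝ φ I) :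
    S.IsSolutionOn (fun t => S.phaseMap e c₀ c' p q σ (S.phase idx ε (torusPoint (φ t)))) I ↔
      ∀ t ∈ I, HasDerivAt φ (fun i => ν (idx.symm i) *
        Real.sqrt (S.radiusSq c₀ c' p q σ (S.phase idx ε (torusPoint (φ t))))) t := by
  refine forall₂_congr fun t ht => ?_
  have hM : ∀ t, S.phaseMap e c₀ c' p q σ (S.phase idx ε (torusPoint (φ t))) ∈
      S.levelSet c₀ c c' := fun t =>
    S.phaseMap_mem_levelSet hc₀ he he1 hf hσ
      (S.inner_B_phase hf hdim hσ hε (torusPoint_mem _)) (hR _ (torusPoint_mem _))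
  obtain ⟨ψ, hψ⟩ : ∃ ψ, HasDerivAt φ ψ t :=
    ⟨_, (hφ.differentiableAt (hI.mem_nhds ht)).hasDerivAt⟩
  have hw := S.hasDerivAt_phase idx ε hψ
  set w : ℝ → Fin S.g → ℂ := fun t => S.phase idx ε (torusPoint (φ t)) with hwdef
  have hRw : 0 < S.radiusSq c₀ c' p q σ (w t) := hR _ (torusPoint_mem _)
  have hX : ∀ k, HasDerivAt (fun t => ellipsePoint (p k) (q k) σ (w t k)) _ t :=
    fun k => hasDerivAt_ellipsePoint (p k) (q k) σ (hw k)
  -- The value of `ρ'` is never needed; only tangency to the sphere of constant norm is used.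
  obtain ⟨ρ', hρ'⟩ : ∃ ρ', HasDerivAt (fun t => σ * Real.sqrt (S.radiusSq c₀ c' p q σ (w t)))
      ρ' t := by
    have h1 : DifferentiableAt ℝ w t := (hasDerivAt_pi.2 hw).differentiableAt
    have h2 : DifferentiableAt ℝ (fun t => S.radiusSq c₀ c' p q σ (w t)) t :=
      (((S.contDiff_radiusSq c₀ c' p q σ).differentiable (by simp)).differentiableAt (x := w t)).comp
        t h1
    exact ⟨_, ((h2.sqrt hRw.ne').const_mul σ).hasDerivAt⟩
  have hx := ((hρ'.smul_const e).add_const c₀).add (HasDerivAt.fun_sum (u := Finset.univ)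
    fun k _ => hX k)
  set V : Fin S.g → 𝔤 := fun k =>
    S.phaseRate idx ψ k • (-(w t k).im • p k + (σ * (w t k).re) • q k) with hVdef
  have hx : HasDerivAt (fun t => S.phaseMap e c₀ c' p q σ (w t)) (ρ' • e + ∑ k, V k) t := hx
  have hVm : ∀ k, V k ∈ S.d k := fun k => Submodule.smul_mem _ _
    (add_mem (Submodule.smul_mem _ _ (hf k).p_mem) (Submodule.smul_mem _ _ (hf k).q_mem))
  have hXm : ∀ k, ellipsePoint (p k) (q k) σ (w t k) ∈ S.d k :=
    fun k => ellipsePoint_mem (hf k).p_mem (hf k).q_mem _ _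
  have horth : inner ℝ (S.phaseMap e c₀ c' p q σ (w t)) (ρ' • e + ∑ k, V k) = 0 := by
    have h1 := hx.inner ℝ hx
    have h2 : (fun t => inner ℝ (S.phaseMap e c₀ c' p q σ (w t))
        (S.phaseMap e c₀ c' p q σ (w t))) = fun _ => c' := funext fun t => (hM t).2.2.2
    rw [h2] at h1
    have h3 := h1.unique (hasDerivAt_const t c')
    rw [real_inner_comm (S.phaseMap e c₀ c' p q σ (w t)) (ρ' • e + ∑ k, V k)] at h3
    linarith
  set ρ := Real.sqrt (S.radiusSq c₀ c' p q σ (w t)) with hρ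
  have hρ0 : 0 < ρ := Real.sqrt_pos.2 hRw
  have hσ0 : σ ≠ 0 := by rintro rfl; norm_num at hσ
  have key := S.sub_lie_mem_orthogonal_iff (y := (σ * ρ) • e) (x₀ := c₀) (v₁ := ρ' • e)
    (X := fun k => ellipsePoint (p k) (q k) σ (w t k)) (V := V) (Submodule.smul_mem _ _ he) hc₀ hXm
    (fun z hz => by
      obtain ⟨a, rfl⟩ := hu z hz
      exact ⟨a / (σ * ρ), by rw [smul_smul, div_mul_cancel₀ _ (mul_ne_zero hσ0 hρ0.ne')]⟩)
    (Submodule.smul_mem _ _ he) hVm horth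
  -- One factor `σ` comes from `y = σ ρ e`, the other from the semi-axis `σ q`. With `σ² = 1` they
  -- leave the rate `ν_k ρ`, the same constant `ν_k` for either sign of `y`.
  have hlie : ∀ k, ∀ z ∈ S.d k, inner ℝ ⁅(σ * ρ) • e, S.B (ellipsePoint (p k) (q k) σ (w t k))⁆ z =
      (ν k * ρ) * inner ℝ (-(w t k).im • p k + (σ * (w t k).re) • q k) z := fun k z hz => by
    rw [ellipsePoint, map_add, map_smul, map_smul, smul_lie, lie_add, lie_smul, lie_smul,
      inner_smul_left, inner_add_left, inner_smul_left, inner_smul_left, (hf k).lie_p z hz,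
      (hf k).lie_q z hz, inner_add_left, inner_smul_left, inner_smul_left]
    simp only [conj_trivial]
    linear_combination (-(ρ * (w t k).im * ν k * inner ℝ (p k) z)) * hσ
  have hVz : ∀ k z, inner ℝ (V k) z =
      S.phaseRate idx ψ k * inner ℝ (-(w t k).im • p k + (σ * (w t k).re) • q k) z :=
    fun k z => by rw [hVdef, inner_smul_left, conj_trivial]
  have hfin : (∀ k, ∀ z ∈ S.d k, inner ℝ (V k) z =
      inner ℝ ⁅(σ * ρ) • e, S.B (ellipsePoint (p k) (q k) σ (w t k))⁆ z) ↔
        ψ = fun i => ν (idx.symm i) * ρ := by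
    constructor
    · intro h
      funext i
      obtain ⟨⟨k, hk⟩, rfl⟩ := idx.surjective i
      -- This is the point a quarter turn ahead on the same ellipse, hence a nonzero tangent vector.
      -- Testing the equation against it extracts the rate.
      set n := -(w t k).im • p k + (σ * (w t k).re) • q k with hn
      have hnm : n ∈ S.d k :=
        add_mem (Submodule.smul_mem _ _ (hf k).p_mem) (Submodule.smul_mem _ _ (hf k).q_mem)
      have hnB : inner ℝ (S.B n) n = c k := by
        rw [hn, (hf k).inner_B, (hf k).two hk, mul_pow, hσ]
        linear_combination c k * S.norm_phase idx hε (torusPoint_mem (φ t)) k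
      have hn0 : n ≠ 0 := by
        intro h; rw [h] at hnB; simp at hnB; exact (hcpos k).ne hnB
      have h1 := h k n hnm
      rw [hVz, hlie k n hnm] at h1
      have h2 := mul_right_cancel₀ (inner_self_ne_zero.2 hn0) h1
      rw [phaseRate, dif_pos hk] at h2
      simpa using h2
    · rintro rfl k z hz
      rw [hVz, hlie k z hz]
      -- On a line both sides vanish: the phase is a constant sign and `ν = 0`.
      rcases hdim k with h | h
      · rw [phaseRate, dif_neg (by omega), ((hf k).one h).2]
        ring
      · rw [phaseRate, dif_pos h]
        simp
  constructor
  · rintro ⟨-, v, hv, hv'⟩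
    rw [hv.unique hx] at hv'
    rw [← hfin.1 (key.1 hv')]
    exact hψ
  · intro h
    exact ⟨(hM t).1, _, hx, key.2 (hfin.2 (hψ.unique h))⟩

end Torus

/-! ### Enumeration of the tori by signs. -/

/-- The sign of a truth value. -/
noncomputable def boolSign (b : Bool) : ℝ := if b then 1 else -1

theorem boolSign_eq (b : Bool) : boolSign b = 1 ∨ boolSign b = -1 := by
  cases b <;> simp [boolSign]

theorem boolSign_sq (b : Bool) : boolSign b ^ 2 = 1 := by
  cases b <;> simp [boolSign]

theorem boolSign_injective : Function.Injective boolSign := by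
  intro a b h
  cases a <;> cases b <;> simp [boolSign] at h ⊢ <;> norm_num at h

theorem exists_boolSign {a : ℝ} (h : a = 1 ∨ a = -1) : ∃ b, boolSign b = a := by
  rcases h with rfl | rfl
  · exact ⟨true, by simp [boolSign]⟩
  · exact ⟨false, by simp [boolSign]⟩

/-- A choice of signs on the lines among the `𝔡_k`. -/
noncomputable def lineSign (s : {k // Module.finrank ℝ (S.d k) = 1} → Bool) (k : Fin S.g) : ℝ :=
  if h : Module.finrank ℝ (S.d k) = 1 then boolSign (s ⟨k, h⟩) else 1

theorem lineSign_sq (s : {k // Module.finrank ℝ (S.d k) = 1} → Bool) (k : Fin S.g) :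
    S.lineSign s k ^ 2 = 1 := by
  unfold lineSign
  split_ifs with h
  · exact boolSign_sq _
  · norm_num

theorem exists_lineSign {ε : Fin S.g → ℝ} (h : ∀ k, ε k = 1 ∨ ε k = -1)
    (h1 : ∀ k, Module.finrank ℝ (S.d k) ≠ 1 → ε k = 1) : ∃ s, S.lineSign s = ε := by
  choose b hb using fun k => exists_boolSign (h k)
  refine ⟨fun k => b k, funext fun k => ?_⟩
  unfold lineSign
  split_ifs with hk
  · exact hb k
  · exact (h1 k hk).symm

theorem finrank_d_pos [FiniteDimensional ℝ 𝔤] (k : Fin S.g) : 0 < Module.finrank ℝ (S.d k) :=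
  Nat.pos_of_ne_zero fun h => S.𝔡_inf_w_ne_bot k (Submodule.finrank_eq_zero.1 h)

theorem exists_unit_u (h : Module.finrank ℝ S.u = 1) :
    ∃ e ∈ S.u, ‖e‖ = 1 ∧ ∀ z ∈ S.u, ∃ a : ℝ, z = a • e := by
  obtain ⟨v, hv, hspan⟩ := finrank_eq_one_iff'.1 h
  have hv0 : ‖(v : 𝔤)‖ ≠ 0 := by simpa using hv
  refine ⟨‖(v : 𝔤)‖⁻¹ • (v : 𝔤), Submodule.smul_mem _ _ v.2,
    normalize_norm_eq_one (norm_ne_zero_iff.1 hv0), fun z hz => ?_⟩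
  obtain ⟨a, ha⟩ := hspan ⟨z, hz⟩
  exact ⟨a * ‖(v : 𝔤)‖, by
    rw [smul_smul, mul_assoc, mul_inv_cancel₀ hv0, mul_one]; exact (congrArg Subtype.val ha).symm⟩

/-- Each torus fixes the sign of `y` and one sign for each line, which gives `2 · 2^p` choices; the
angles on the planes remain free. The signs can be read off from a point, so different choices give
disjoint tori. -/
theorem levelSet_isUnionOfTori [FiniteDimensional ℝ 𝔤] {c₀ : 𝔤} (hc₀ : c₀ ∈ S.d₀)
    {c b : Fin S.g → ℝ} {c' : ℝ}
    (hB : ∀ k, S.BPosDef k) (hcpos : ∀ k, 0 < c k)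
    (hb : ∀ k, IsLeast (S.unitValues k) (b k)) (hc : ‖c₀‖ ^ 2 + ∑ k, c k / b k < c')
    (hd : ∀ k, Module.finrank ℝ (S.d k) ≤ 2) (hu1 : Module.finrank ℝ S.u = 1) :
    S.IsUnionOfTori (S.levelSet c₀ c c')
      (2 ^ (1 + Nat.card {k : Fin S.g // Module.finrank ℝ (S.d k) = 1}))
      (Nat.card {k : Fin S.g // Module.finrank ℝ (S.d k) = 2}) := by
  have hdim : ∀ k, Module.finrank ℝ (S.d k) = 1 ∨ Module.finrank ℝ (S.d k) = 2 := fun k => by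
    have := S.finrank_d_pos k; have := hd k; omega
  obtain ⟨e, he, he1, hu⟩ := S.exists_unit_u hu1
  choose p q ν hf using fun k => (hdim k).elim (S.exists_ellipseFrame_one e (hB k) (hcpos k))
    (S.exists_ellipseFrame_two e (hB k) (hcpos k))
  let idx : {k // Module.finrank ℝ (S.d k) = 2} ≃
      Fin (Nat.card {k : Fin S.g // Module.finrank ℝ (S.d k) = 2}) := Finite.equivFin _
  let sgn : Bool × ({k // Module.finrank ℝ (S.d k) = 1} → Bool) ≃
      Fin (2 ^ (1 + Nat.card {k : Fin S.g // Module.finrank ℝ (S.d k) = 1})) :=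
    Fintype.equivFinOfCardEq (by
      rw [Fintype.card_prod, Fintype.card_fun, Fintype.card_bool, Nat.card_eq_fintype_card,
        pow_add, pow_one])
  let f : Bool × ({k // Module.finrank ℝ (S.d k) = 1} → Bool) → (Fin _ → ℂ) → 𝔤 := fun s z =>
    S.phaseMap e c₀ c' p q (boolSign s.1) (S.phase idx (S.lineSign s.2) z)
  have hR : ∀ (s : Bool × ({k // Module.finrank ℝ (S.d k) = 1} → Bool)), ∀ z ∈ stdTorus _,
      0 < S.radiusSq c₀ c' p q (boolSign s.1) (S.phase idx (S.lineSign s.2) z) := fun s z hz =>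
    S.radius_pos hB hb hc (fun k => ellipsePoint_mem (hf k).p_mem (hf k).q_mem _ _)
      (S.inner_B_phase hf hdim (boolSign_sq _) (S.lineSign_sq _) hz)
  refine ⟨fun j => f (sgn.symm j) '' stdTorus _, fun i => ν (idx.symm i), ?_, ?_, fun j => ?_⟩
  · ext x
    simp only [Set.mem_iUnion, Set.mem_image]
    constructor
    · intro hx
      obtain ⟨σ, ε, z, hσ, hε, hε1, hz, rfl⟩ :=
        S.exists_phaseMap_eq hc₀ he1 hu hcpos hf hdim idx hx
      obtain ⟨s, rfl⟩ := exists_boolSign hσ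
      obtain ⟨s', rfl⟩ := S.exists_lineSign hε hε1
      exact ⟨sgn (s, s'), z, hz, by rw [Equiv.symm_apply_apply]⟩
    · rintro ⟨j, z, hz, rfl⟩
      exact S.phaseMap_mem_levelSet hc₀ he he1 hf (boolSign_sq _)
        (S.inner_B_phase hf hdim (boolSign_sq _) (S.lineSign_sq _) hz) (hR _ z hz)
  · intro i j hij
    rw [Set.disjoint_left]
    rintro _ ⟨z, hz, rfl⟩ ⟨z', hz', h⟩
    obtain ⟨h1, h2⟩ := S.phaseMap_injective hc₀ he he1 hcpos hf (boolSign_eq _) (boolSign_eq _)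
      (hR _ z' hz') (hR _ z hz) h
    refine hij (sgn.symm.injective (Prod.ext (boolSign_injective h1) (funext fun k => ?_))).symm
    have h3 := h2 k k.2
    rw [lineSign, lineSign, dif_pos k.2, dif_pos k.2] at h3
    exact boolSign_injective h3
  · set s := sgn.symm j
    have hinv : ∀ z, S.angleMap idx c p q (boolSign s.1) (f s z) = z := fun z =>
      S.angleMap_phaseMap hc₀ he hcpos hf (boolSign_sq _) z
    have hRt := fun φ => hR s _ (torusPoint_mem φ)
    -- The time factor `Φ` is the reciprocal of the length of the `𝔲`-component. It depends on the
    -- angles through `torusPoint` only, hence is periodic.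
    refine ⟨f s, S.angleMap idx c p q (boolSign s.1), fun φ => (Real.sqrt (S.radiusSq c₀ c' p q
      (boolSign s.1) (S.phase idx (S.lineSign s.2) (torusPoint φ))))⁻¹,
      ⟨Set.mapsTo_image _ _, ?_, ⟨fun z _ => hinv z, ?_⟩, ?_, ?_⟩, ?_, ?_, ?_, ?_⟩
    · rintro _ ⟨z, hz, rfl⟩
      rwa [hinv]
    · rintro _ ⟨z, hz, rfl⟩
      rw [hinv]
    · refine smoothOnSubset_of_eventually fun z hz => ?_
      have hcont : Continuous fun z => S.radiusSq c₀ c' p q (boolSign s.1)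
          (S.phase idx (S.lineSign s.2) z) :=
        (S.contDiff_radiusSq c₀ c' p q _).continuous.comp (S.contDiff_phase idx _).continuous
      filter_upwards [hcont.continuousAt.eventually_const_lt (hR s z hz)] with y hy
      exact (S.contDiffAt_phaseMap e c₀ c' p q _ hy).comp y (S.contDiff_phase idx _).contDiffAt
    · exact fun x _ => ⟨Set.univ, isOpen_univ, trivial, _, S.contDiff_angleMap.contDiffOn,
        fun _ _ => rfl⟩
    · exact (((S.contDiff_radiusSq c₀ c' p q _).comp ((S.contDiff_phase idx _).comp
        contDiff_torusPoint)).sqrt fun φ => (hRt φ).ne').inv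
          fun φ => (Real.sqrt_pos.2 (hRt φ)).ne'
    · exact fun φ => inv_pos.2 (Real.sqrt_pos.2 (hRt φ))
    · intro φ i
      simp only [torusPoint_add_single]
    · intro I φ hI hφ
      simp only [div_inv_eq_mul]
      exact S.isSolutionOn_phaseMap_iff hc₀ he he1 hu hcpos hf hdim (boolSign_sq _)
        (S.lineSign_sq _) (hR s) hI hφ

end EPSData

theorem mainTheorem8 {𝔤 : Type*} [NormedLieRing 𝔤] [InvariantInnerLieAlgebra 𝔤]
    [FiniteDimensional ℝ 𝔤] (S : EPSData 𝔤)
    (c₀ : 𝔤) (hc₀ : c₀ ∈ S.d₀) (c : Fin S.g → ℝ) (c' : ℝ) :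
    -- the level set is invariant
    (∀ (I : Set ℝ) (x : ℝ → 𝔤), IsOpen I → I.OrdConnected → S.IsSolutionOn x I →
      ∀ t₀ ∈ I, x t₀ ∈ S.levelSet c₀ c c' → ∀ t ∈ I, x t ∈ S.levelSet c₀ c c') ∧
    ((∀ k, S.BPosDef k) → (∀ k, 0 < c k) →
      ∀ b : Fin S.g → ℝ, (∀ k, IsLeast (S.unitValues k) (b k)) →
      ‖c₀‖ ^ 2 + ∑ k, c k / b k < c' →
      -- part 1
      DiffeomorphicSets (S.levelSet c₀ c c')
        (sphereProduct (fun k => Module.finrank ℝ (S.d k)) (Module.finrank ℝ S.u)) ∧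
      -- part 2, all the spaces of dimension two
      ((∀ k, Module.finrank ℝ (S.d k) = 2) → Module.finrank ℝ S.u = 1 →
        S.IsUnionOfTori (S.levelSet c₀ c c') 2 S.g) ∧
      -- part 2, with one-dimensional spaces allowed
      ((∀ k, Module.finrank ℝ (S.d k) ≤ 2) → Module.finrank ℝ S.u = 1 →
        S.IsUnionOfTori (S.levelSet c₀ c c')
          (2 ^ (1 + Nat.card {k : Fin S.g // Module.finrank ℝ (S.d k) = 1}))
          (Nat.card {k : Fin S.g // Module.finrank ℝ (S.d k) = 2}))) := by
  refine ⟨fun I x hI hc hx t₀ h₀ hM t ht => S.levelSet_invariant hI hc hx h₀ ht hM,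
    fun hB hcpos b hb hlt => ⟨S.levelSet_diffeomorphic hc₀ hB hcpos hb hlt, fun h2 hu => ?_,
      fun hd hu => S.levelSet_isUnionOfTori hc₀ hB hcpos hb hlt hd hu⟩⟩
  have h := S.levelSet_isUnionOfTori hc₀ hB hcpos hb hlt (fun k => (h2 k).le) hu
  have e1 : Nat.card {k : Fin S.g // Module.finrank ℝ (S.d k) = 1} = 0 := by
    have : IsEmpty {k : Fin S.g // Module.finrank ℝ (S.d k) = 1} :=
      ⟨fun k => by have := h2 k; have := k.2; omega⟩
    exact Nat.card_of_isEmpty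
  have e2 : Nat.card {k : Fin S.g // Module.finrank ℝ (S.d k) = 2} = S.g := by
    rw [Nat.card_congr (Equiv.subtypeUnivEquiv h2), Nat.card_fin]
  -- With no lines the number of tori is `2 ^ (1 + 0)`, which evaluates to `2`.
  rwa [e1, e2] at h
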